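/- **Setting.** Let $(\Omega,\mathcal F,\mathbb P)$ be a probability space and $\mathbb Q\ll\mathbb P$ a pricing measure. The state price density $\varphi_T=e^{-rT}\frac{d\mathbb Q}{d\mathbb P}$ is assumed $\mathbb P$-a.s. positive with a continuous cdf. For a random variable $Y$ with cdf $F_Y$ (under $\mathbb P$) let $\breve F_Y(s)=\inf\{y\in\mathbb R: F_Y(y)\ge s\}$, $0<s<1$, be its quantile function, and write $\breve F_\varphi=\breve F_{\varphi_T}$. Let $X_b\ge 0$ be the benchmark's terminal wealth, $\breve F_b=\breve F_{X_b}$, and let $x_0,\epsilon>0$. The utility $u:[0,\infty)\to\mathbb R$ is continuous, $C^2$ on $(0,\infty)$ with $u'>0$, $u''<0$, $\lim_{x\to0}u'(x)=\infty$ and $\lim_{x\to\infty}u'(x)=0$. The Bregman generator $\phi:[0,\infty)\to\mathbb R$ is convex, continuous, and $C^1$ on $(0,\infty)$; moreover $\phi$ is (right-)differentiable at $0$, or $X_b>0$ a.s. Write $B_\phi(z_1,z_2)=\phi(z_1)-\phi(z_2)-\phi'(z_2)(z_1-z_2)$. For $p\in\{1,2\}$ let $\mathcal Q^p$ be the set of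 non-decreasing, left-continuous $\breve G:(0,1)\to[0,\infty)$ with $\int_0^1\breve G^p\,dt<\infty$. Put $\mathscr B_\phi(\breve G,\breve F_b)=\int_0^1B_\phi(\breve G(t),\breve F_b(t))\,dt$, $\mathfrak c(\breve G)=\int_0^1\breve G(t)\breve F_\varphi(1-t)\,dt$, and $$\mathcal Q^p_\epsilon(x_0)=\{\breve G\in\mathcal Q^p:\ \mathscr B_\phi(\breve G,\breve F_b)\le\epsilon,\ \mathfrak c(\breve G)\le x_0\}.$$ Let $(P_p)$ be the problem of maximising $\int_0^1u(\breve G(t))\,dt$ over $\breve G\in\mathcal Q^p_\epsilon(x_0)$. **Assumptions.** (A) Some $\breve G\in\mathcal Q^2_\epsilon(x_0)$ has $\mathscr B_\phi(\breve G,\breve F_b)<\epsilon$. (B) At least one of the following holds: (i) $\operatorname{ess\,inf}\varphi_T>0$; (ii) $X_b\in L^2$ and $\phi$ is $\vartheta$-strongly convex for some $\vartheta>0$, i.e. $B_\phi(z_1,z_2)\ge\frac\vartheta2(z_1-z_2)^2$ for all $z_1\ge0$, $z_2>0$; (iii) $\phi$ is strictly convex and $X_b$ is bounded above a.s. **Explicit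 form.** Say that $\breve F$ has the *explicit form* if there are $\lambda^*,\mu^*\ge0$ with $$\lambda^*(\mathfrak c(\breve F)-x_0)=0,\qquad \mu^*(\mathscr B_\phi(\breve F,\breve F_b)-\epsilon)=0,$$ such that, with $m(y)=-u(y)+\mu^*\phi(y)$, the derivative $m'$ is injective on $(0,\infty)$ and, for every $t\in(0,1)$ such that $\breve F_\varphi$ is continuous at $1-t$ (hence for all but countably many $t$, and for all $t\in(0,1)$ if $\breve F_\varphi$ is continuous), $$\breve F(t)=\inf\{y> 0:\ m'(y)+\lambda^*\breve F_\varphi(1-t)-\mu^*\phi'(\breve F_b(t))\ge0\}$$ (where $\inf\emptyset=+\infty$), the number $-\lambda^*\breve F_\varphi(1-t)+\mu^*\phi'(\breve F_b(t))$ lies in the range $m'((0,\infty))$, and $$\breve F(t)=(m')^{-1}\Big(-\lambda^*\breve F_\varphi(1-t)+\mu^*\phi'\big(\breve F_b(t)\big)\Big).$$ **Statement.** Under (A) and (B): 1. every solution $\breve F^*$ of $(P_2)$ is the unique solution of $(P_2)$ and has the explicit form; 2. in case (ii), $(P_2)$ has a solution; 3. in each of the cases (i), (ii), (iii), $(P_1)$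 has a unique solution, and it has the explicit form. -/

import Mathlib

open MeasureTheory ProbabilityTheory Set Filter Topology

noncomputable section

namespace BWPortfolio

/-- The left-continuous quantile function `inf {y | u ≤ F(y)}` of a law on the real line with
cdf `F`; it is only used at `u ∈ (0,1)`. -/
def quantile (ν : Measure ℝ) (u : ℝ) : ℝ :=
  sInf {y : ℝ | u ≤ cdf ν y}

/-- The quantile function of a real random variable `X` under `P`. -/
def quantileOf {Ω : Type*} [MeasurableSpace Ω] (P : Measure Ω) (X : Ω → ℝ) : ℝ → ℝ :=
  quantile (P.map X)

/-- The state price density `e^{-rT} dℚ/dℙ`. -/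
def statePriceDensity {Ω : Type*} [MeasurableSpace Ω] (P Q : Measure Ω) (r T : ℝ) (ω : Ω) : ℝ :=
  Real.exp (-(r * T)) * (Q.rnDeriv P ω).toReal

/-- Utility functions `u : [0,∞) → ℝ`: continuous, twice continuously differentiable on `(0,∞)`
with `u' > 0` and `u'' < 0`, and satisfying the Inada conditions (so that `u` has no finite
derivative at `0`). Values at negative arguments play no role. -/
structure IsUtility (u : ℝ → ℝ) : Prop where
  continuousOn : ContinuousOn u (Ici 0)
  contDiffOn : ContDiffOn ℝ 2 u (Ioi 0)
  deriv_pos : ∀ x, 0 < x → 0 < deriv u x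
  deriv_deriv_neg : ∀ x, 0 < x → deriv (deriv u) x < 0
  inada_zero : Tendsto (deriv u) (𝓝[>] 0) atTop
  inada_top : Tendsto (deriv u) atTop (𝓝 0)

/-- The derivative `φ'` of a function on `[0,∞)` (the right derivative at `0`). -/
def dgen (φ : ℝ → ℝ) (z : ℝ) : ℝ := derivWithin φ (Ici 0) z

/-- Bregman generators on `[0,∞)`: convex, continuous, and continuously differentiable on `(0,∞)`.
Differentiability at `0` is deliberately not part of this definition, so that `x ln x` is
included. Values at negative arguments play no role. -/
structure IsBregmanGenerator (φ : ℝ → ℝ) : Prop where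
  convexOn : ConvexOn ℝ (Ici 0) φ
  continuousOn : ContinuousOn φ (Ici 0)
  contDiffOn : ContDiffOn ℝ 1 φ (Ioi 0)

/-- The Bregman divergence `B_φ(z₁, z₂)`. -/
def bregman (φ : ℝ → ℝ) (z₁ z₂ : ℝ) : ℝ :=
  φ z₁ - φ z₂ - dgen φ z₂ * (z₁ - z₂)

/-- `ϑ`-strong convexity on `[0,∞)` for some `ϑ > 0`. -/
def IsStronglyConvex (φ : ℝ → ℝ) : Prop :=
  ∃ θ : ℝ, 0 < θ ∧ ∀ z₁ z₂ : ℝ, 0 ≤ z₁ → 0 < z₂ →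
    φ z₂ + dgen φ z₂ * (z₁ - z₂) + θ / 2 * (z₁ - z₂) ^ 2 ≤ φ z₁

/-- The Bregman-Wasserstein divergence `∫₀¹ B_φ(G(t), F(t)) dt ∈ [0,∞]` of quantile functions. -/
def bwDiv (φ G F : ℝ → ℝ) : ENNReal :=
  ∫⁻ t in Ioo (0 : ℝ) 1, ENNReal.ofReal (bregman φ (G t) (F t))

/-- The cost `∫₀¹ G(t) p(1-t) dt ∈ [0,∞]`, where `p` is the quantile function of the state price
density. -/
def cost (p G : ℝ → ℝ) : ENNReal :=
  ∫⁻ t in Ioo (0 : ℝ) 1, ENNReal.ofReal (G t * p (1 - t))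

/-- The expected utility `∫₀¹ u(G(t)) dt`. -/
def expectedUtility (u G : ℝ → ℝ) : ℝ :=
  ∫ t in Ioo (0 : ℝ) 1, u (G t)

/-- Non-negative, non-decreasing, left-continuous functions on `(0,1)`. A function on `(0,1)` is
represented by a function on `ℝ` whose values outside `(0,1)` play no role. -/
structure IsNonnegQuantile (G : ℝ → ℝ) : Prop where
  nonneg : ∀ t ∈ Ioo (0 : ℝ) 1, 0 ≤ G t
  monotoneOn : MonotoneOn G (Ioo 0 1)
  leftCont : ∀ t ∈ Ioo (0 : ℝ) 1, ContinuousWithinAt G (Iic t) t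

/-- Quantile functions of non-negative square-integrable random variables. -/
def quantilesL2 : Set (ℝ → ℝ) :=
  {G | IsNonnegQuantile G ∧ IntegrableOn (fun t => G t ^ 2) (Ioo 0 1)}

/-- Quantile functions of non-negative integrable random variables. -/
def quantilesL1 : Set (ℝ → ℝ) :=
  {G | IsNonnegQuantile G ∧ IntegrableOn G (Ioo 0 1)}

/-- The members of the class `𝒞` of quantile functions with Bregman-Wasserstein divergence at most
`ε` from the benchmark quantile function `Fb` and with cost at most `x₀`. -/
def feasible (𝒞 : Set (ℝ → ℝ)) (φ p Fb : ℝ → ℝ) (x₀ ε : ℝ) : Set (ℝ → ℝ) :=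
  {G | G ∈ 𝒞 ∧ bwDiv φ G Fb ≤ ENNReal.ofReal ε ∧ cost p G ≤ ENNReal.ofReal x₀}

/-- `F` maximises expected utility over the feasible members of the class `𝒞`. -/
def Solves (𝒞 : Set (ℝ → ℝ)) (u φ p Fb : ℝ → ℝ) (x₀ ε : ℝ) (F : ℝ → ℝ) : Prop :=
  F ∈ feasible 𝒞 φ p Fb x₀ ε ∧ IsMaxOn (expectedUtility u) (feasible 𝒞 φ p Fb x₀ ε) F

/-- `F` is a solution, and every solution agrees with `F` on `(0,1)`. -/
def IsUniqueSolution (𝒞 : Set (ℝ → ℝ)) (u φ p Fb : ℝ → ℝ) (x₀ ε : ℝ) (F : ℝ → ℝ) : Prop :=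
  Solves 𝒞 u φ p Fb x₀ ε F ∧ ∀ G, Solves 𝒞 u φ p Fb x₀ ε G → EqOn G F (Ioo 0 1)

/-- `m(y) = -u(y) + μ φ(y)`. -/
def mFun (u φ : ℝ → ℝ) (mu y : ℝ) : ℝ := -u y + mu * φ y

/-- `h_t(y) = m(y) + λ y p(1-t) - μ φ'(Fb(t)) y`. -/
def hFun (u φ p Fb : ℝ → ℝ) (lam mu t y : ℝ) : ℝ :=
  mFun u φ mu y + lam * y * p (1 - t) - mu * dgen φ (Fb t) * y

/-- `inf {y ≥ 0 | h_t'(y) ≥ 0}`, with `inf ∅ = +∞`. Since `h_t'(y) → -∞` as `y → 0`, the point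
`y = 0` never belongs to the set, which is why only `y > 0` is considered. -/
def lagrangeQuantile (u φ p Fb : ℝ → ℝ) (lam mu t : ℝ) : EReal :=
  sInf ((fun y : ℝ => (y : EReal)) '' {y : ℝ | 0 < y ∧ 0 ≤ deriv (hFun u φ p Fb lam mu t) y})

/-- There are multipliers `λ, μ ≥ 0` satisfying the complementary slackness conditions, for which
`m' : (0,∞) → ℝ` is injective and, at all `t ∈ (0,1)` such that `p` is continuous at `1-t`,
`F(t)` is the pointwise minimiser `inf {y | h_t'(y) ≥ 0}` and
`F(t) = (m')⁻¹(-λ p(1-t) + μ φ'(Fb(t)))`, the argument being in the range of `m'`. -/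
def HasLagrangeForm (u φ p Fb : ℝ → ℝ) (x₀ ε : ℝ) (F : ℝ → ℝ) : Prop :=
  ∃ lam mu : ℝ, 0 ≤ lam ∧ 0 ≤ mu ∧
    lam * ((cost p F).toReal - x₀) = 0 ∧
    mu * ((bwDiv φ F Fb).toReal - ε) = 0 ∧
    InjOn (deriv (mFun u φ mu)) (Ioi 0) ∧
    ∀ t ∈ Ioo (0 : ℝ) 1, ContinuousAt p (1 - t) →
      (F t : EReal) = lagrangeQuantile u φ p Fb lam mu t ∧
      -lam * p (1 - t) + mu * dgen φ (Fb t) ∈ deriv (mFun u φ mu) '' Ioi 0 ∧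
      F t = Function.invFunOn (deriv (mFun u φ mu)) (Ioi 0)
        (-lam * p (1 - t) + mu * dgen φ (Fb t))

end BWPortfolio

end

/-!
The problem is a concave maximisation under two convex constraints, and every solution is found by
minimising the Lagrangian pointwise.

*Multipliers.* The set of triples dominating (cost excess, divergence excess, utility deficit) of
some function with finite cost and divergence is open and convex, and at a solution `F` it misses
the origin. A separating hyperplane yields multipliers `λ, μ ≥ 0` with complementary slackness for
which `F` maximises the Lagrangian (`IsMarket.exists_multipliers`). The hypotheses give strict
feasibility only for the divergence constraint, but lowering a quantile function to `0` on `(0, s]`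
saves cost at a finite divergence (`IsMarket.exists_strictly_feasible`).

*Pointwise form.* Up to a term free of `y`, the integrand of the negative Lagrangian at `t` is the
strictly convex function `h_t`, with `h_t'(y) = m'(y) - w(t)` and
`w(t) = -λ p(1-t) + μ φ'(Fb(t))`. As `w` is non-decreasing, so is the minimiser of `h_t` over
`[0, n]`: the monotonicity constraint does not bind. Replacing `F` by its minimum with that
minimiser on `(0, s]`, or by its maximum with it on `(s, 1)`, gives monotone competitors. Their
divergence is finite: `B(y, z)` decreases as `y` moves towards `z`, and past `z` it is bounded on
the regions in question, where `Fb` is bounded, respectively where `y ≤ n` and `φ'(Fb)` is bounded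
below. Hence `F` agrees almost everywhere with the minimiser
(`IsMarket.ae_le_cappedMinimiser`, `IsMarket.ae_cappedMinimiser_le`), so that `m'(F(t)) = w(t)`
for almost every `t`, and by left-continuity at every `t` such that `p` is continuous at `1 - t`
(`IsMarket.deriv_mFun_eq`). No case distinction on the vanishing of `λ` or `μ` is needed: `w(t)` is
in the range of `m'` because `F(t)` is a preimage.

*Uniqueness* follows from strict concavity of the utility (`IsMarket.isUniqueSolution`).

*Existence.* Each of the three well-posedness conditions bounds `∫ G` over the feasible `G`. Helly's
selection theorem extracts an almost everywhere convergent maximising sequence, Fatou's lemma keeps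
its limit feasible, and since `u(y) ≤ δ y + C_δ` for every `δ > 0`, no expected utility is lost in
the limit (`IsMarket.exists_solves`). Under strong convexity and a square-integrable benchmark the
feasible functions are square-integrable, so both classes define the same problem.
-/

open MeasureTheory ProbabilityTheory Set Filter Topology

namespace BWPortfolio

/-! ### Quantile functions of laws on the real line -/

section Quantile

variable {ν : Measure ℝ}

theorem quantile_set_nonempty {t : ℝ} (ht : t < 1) : {y : ℝ | t ≤ cdf ν y}.Nonempty := by
  obtain ⟨y, hy⟩ := ((tendsto_cdf_atTop ν).eventually (lt_mem_nhds ht)).exists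
  exact ⟨y, hy.le⟩

theorem quantile_set_bddBelow {t : ℝ} (ht : 0 < t) : BddBelow {y : ℝ | t ≤ cdf ν y} := by
  obtain ⟨y, hy⟩ := ((tendsto_cdf_atBot ν).eventually (gt_mem_nhds ht)).exists
  exact ⟨y, fun z hz => le_of_not_gt fun hzy =>
    absurd (hz.trans (monotone_cdf ν hzy.le)) (not_le.2 hy)⟩

/-- The Galois connection between the quantile function and the cdf. -/
theorem quantile_le_iff {t : ℝ} (ht : t ∈ Ioo (0 : ℝ) 1) (x : ℝ) :
    quantile ν t ≤ x ↔ t ≤ cdf ν x := by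
  refine ⟨fun h => ?_, fun h => csInf_le (quantile_set_bddBelow ht.1) h⟩
  have key : ∀ y, x < y → t ≤ cdf ν y := fun y hy => by
    obtain ⟨z, hz, hzy⟩ := (csInf_lt_iff (quantile_set_bddBelow ht.1)
      (quantile_set_nonempty ht.2)).1 (lt_of_le_of_lt h hy)
    exact le_trans hz (monotone_cdf ν hzy.le)
  have hr : Tendsto (cdf ν) (𝓝[>] x) (𝓝 (cdf ν x)) :=
    ((cdf ν).right_continuous x).mono_left (nhdsWithin_mono _ Ioi_subset_Ici_self)
  exact ge_of_tendsto hr (eventually_mem_nhdsWithin.mono key)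

theorem lt_quantile_iff {t : ℝ} (ht : t ∈ Ioo (0 : ℝ) 1) (x : ℝ) :
    x < quantile ν t ↔ cdf ν x < t := by
  rw [← not_le, quantile_le_iff ht, not_le]

theorem monotoneOn_quantile : MonotoneOn (quantile ν) (Ioo 0 1) := fun s hs t ht hst => by
  rw [quantile_le_iff hs]
  exact hst.trans ((quantile_le_iff ht _).1 le_rfl)

theorem quantile_leftCont {t : ℝ} (ht : t ∈ Ioo (0 : ℝ) 1) :
    ContinuousWithinAt (quantile ν) (Iic t) t := by
  have hI : Ioo (0 : ℝ) 1 ∈ 𝓝[≤] t := mem_nhdsWithin_of_mem_nhds (Ioo_mem_nhds ht.1 ht.2)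
  refine tendsto_order.2 ⟨fun a ha => ?_, fun a ha => ?_⟩
  · have h1 := (lt_quantile_iff ht a).1 ha
    filter_upwards [hI, mem_nhdsWithin_of_mem_nhds (Ioi_mem_nhds h1)] with s hs hs1
    exact (lt_quantile_iff hs a).2 hs1
  · filter_upwards [hI, self_mem_nhdsWithin] with s hs hs1
    exact lt_of_le_of_lt (monotoneOn_quantile hs ht hs1) ha

instance isProbabilityMeasure_restrict_Ioo :
    IsProbabilityMeasure (volume.restrict (Ioo (0 : ℝ) 1)) :=
  ⟨by simp⟩

theorem aemeasurable_quantile :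
    AEMeasurable (quantile ν) (volume.restrict (Ioo (0 : ℝ) 1)) :=
  aemeasurable_restrict_of_monotoneOn measurableSet_Ioo monotoneOn_quantile

variable [IsProbabilityMeasure ν]

/-- A uniform variable transformed by the quantile function of `ν` has law `ν`. -/
theorem map_quantile : (volume.restrict (Ioo (0 : ℝ) 1)).map (quantile ν) = ν := by
  have : IsProbabilityMeasure ((volume.restrict (Ioo (0 : ℝ) 1)).map (quantile ν)) :=
    Measure.isProbabilityMeasure_map aemeasurable_quantile
  refine Measure.eq_of_cdf _ _ ?_
  ext x
  rw [cdf_eq_real, measureReal_def, Measure.map_apply_of_aemeasurable aemeasurable_quantile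
    measurableSet_Iic]
  have h0 := cdf_nonneg ν x
  have h1 := cdf_le_one ν x
  have hset : (volume.restrict (Ioo (0 : ℝ) 1)) (quantile ν ⁻¹' Iic x) =
      volume (Ioo (0 : ℝ) 1 ∩ Iic (cdf ν x)) := by
    rw [Measure.restrict_apply₀' measurableSet_Ioo.nullMeasurableSet]
    congr 1
    ext t
    constructor
    · rintro ⟨h, h'⟩
      exact ⟨h', (quantile_le_iff h' x).1 h⟩
    · rintro ⟨h', h⟩
      exact ⟨(quantile_le_iff h' x).2 h, h'⟩
  have hvol : volume (Ioo (0 : ℝ) 1 ∩ Iic (cdf ν x)) = ENNReal.ofReal (cdf ν x) := by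
    refine le_antisymm ?_ ?_
    · refine (measure_mono (t := Ioc 0 (cdf ν x)) fun t ht => ⟨ht.1.1, ht.2⟩).trans ?_
      simp
    · refine le_trans ?_ (measure_mono (s := Ioo 0 (cdf ν x))
        fun t ht => ⟨⟨ht.1, ht.2.trans_le h1⟩, ht.2.le⟩)
      simp
  rw [hset, hvol, ENNReal.toReal_ofReal h0]

theorem integrableOn_quantile_comp {g : ℝ → ℝ} (hg : Integrable g ν) :
    IntegrableOn (fun t => g (quantile ν t)) (Ioo 0 1) := by
  rw [← map_quantile (ν := ν)] at hg
  exact hg.comp_aemeasurable aemeasurable_quantile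

theorem lt_quantile_of_ae {a : ℝ} (h : ∀ᵐ x ∂ν, a < x) {t : ℝ} (ht : t ∈ Ioo (0 : ℝ) 1) :
    a < quantile ν t := by
  rw [lt_quantile_iff ht, cdf_eq_real, measureReal_def]
  have : ν (Iic a) = 0 := by
    rw [← ae_iff.1 h]; congr 1; ext; simp
  simpa [this] using ht.1

theorem le_quantile_of_ae {a : ℝ} (h : ∀ᵐ x ∂ν, a ≤ x) {t : ℝ} (ht : t ∈ Ioo (0 : ℝ) 1) :
    a ≤ quantile ν t :=
  le_of_forall_lt fun _ hb => lt_quantile_of_ae (h.mono fun _ hx => hb.trans_le hx) ht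

theorem quantile_le_of_ae {a : ℝ} (h : ∀ᵐ x ∂ν, x ≤ a) {t : ℝ} (ht : t ∈ Ioo (0 : ℝ) 1) :
    quantile ν t ≤ a := by
  have h1 : ν (Iic a) = 1 := (prob_compl_eq_zero_iff measurableSet_Iic).1 (ae_iff.1 h)
  simpa [quantile_le_iff ht, cdf_eq_real, measureReal_def, h1] using ht.2.le

end Quantile

/-! ### Bregman divergences -/

section Bregman

variable {φ : ℝ → ℝ}

theorem bregman_self (z : ℝ) : bregman φ z z = 0 := by simp [bregman]

/-- The tangent inequality for the generator. -/
theorem bregman_nonneg (hφ : ConvexOn ℝ (Ici 0) φ) {y z : ℝ} (hy : 0 ≤ y) (hz : 0 ≤ z)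
    (hd : DifferentiableWithinAt ℝ φ (Ici 0) z) : 0 ≤ bregman φ y z := by
  unfold bregman dgen
  rcases lt_trichotomy y z with h | h | h
  · have := hφ.slope_le_derivWithin (mem_Ici.2 hy) hz h hd
    rw [slope_def_field, div_le_iff₀ (sub_pos.2 h)] at this
    linarith
  · simp [h]
  · have := hφ.derivWithin_le_slope (mem_Ici.2 hz) hy h hd
    rw [slope_def_field, le_div_iff₀ (sub_pos.2 h)] at this
    linarith

theorem bregman_convex_left (hφ : ConvexOn ℝ (Ici 0) φ) (z : ℝ) :
    ConvexOn ℝ (Ici 0) (fun y => bregman φ y z) := by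
  refine ⟨hφ.1, fun x hx y hy a b ha hb hab => ?_⟩
  have := hφ.2 hx hy ha hb hab
  obtain rfl : b = 1 - a := by linarith
  simp only [smul_eq_mul, bregman] at *
  linarith

/-- The divergence decreases when its first argument moves towards the second one. -/
theorem bregman_le_of_mem_segment (hφ : ConvexOn ℝ (Ici 0) φ) {x y z : ℝ} (hx : 0 ≤ x)
    (hz : 0 ≤ z) (hd : DifferentiableWithinAt ℝ φ (Ici 0) z) (hy : y ∈ segment ℝ x z) :
    bregman φ y z ≤ bregman φ x z := by
  refine ((bregman_convex_left hφ z).le_on_segment (mem_Ici.2 hx) (mem_Ici.2 hz) hy).trans ?_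
  rw [bregman_self]
  exact max_le le_rfl (bregman_nonneg hφ hx hz hd)

theorem dgen_mono (hφ : ConvexOn ℝ (Ici 0) φ) {y z : ℝ} (hy : 0 ≤ y) (hyz : y ≤ z)
    (hdy : DifferentiableWithinAt ℝ φ (Ici 0) y) (hdz : DifferentiableWithinAt ℝ φ (Ici 0) z) :
    dgen φ y ≤ dgen φ z := by
  rcases hyz.eq_or_lt with rfl | h
  · exact le_rfl
  · exact (hφ.derivWithin_le_slope (mem_Ici.2 hy) (mem_Ici.2 (hy.trans hyz)) h hdy).trans
      (hφ.slope_le_derivWithin (mem_Ici.2 hy) (mem_Ici.2 (hy.trans hyz)) h hdz)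

/-- Although `φ'` may be unbounded near `0`, the divergence `B(0, z)` is controlled by values
of `φ` alone, because `φ'(z) z ≤ φ(2z) - φ(z)`. -/
theorem bregman_zero_le (hφ : ConvexOn ℝ (Ici 0) φ) {z : ℝ} (hz : 0 ≤ z)
    (hd : DifferentiableWithinAt ℝ φ (Ici 0) z) :
    bregman φ 0 z ≤ φ 0 - 2 * φ z + φ (2 * z) := by
  have := bregman_nonneg hφ (y := 2 * z) (by linarith) hz hd
  simp only [bregman] at *
  linarith

theorem exists_bound_on_Icc (hc : ContinuousOn φ (Ici 0)) (R : ℝ) :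
    ∃ C, 0 ≤ C ∧ ∀ y ∈ Icc 0 R, |φ y| ≤ C := by
  obtain ⟨C, hC⟩ := isCompact_Icc.exists_bound_of_continuousOn
    (hc.mono (Icc_subset_Ici_self : Icc 0 R ⊆ Ici 0))
  exact ⟨max C 0, le_max_right _ _, fun y hy => (hC y hy).trans (le_max_left _ _)⟩

/-- A bound for `B(0, z)` that is uniform over `z` in a bounded interval. -/
theorem exists_bregman_zero_bound (hφ : IsBregmanGenerator φ) (R : ℝ) :
    ∃ C, ∀ z ∈ Icc 0 R, DifferentiableWithinAt ℝ φ (Ici 0) z → bregman φ 0 z ≤ C := by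
  obtain ⟨C, hC0, hC⟩ := exists_bound_on_Icc hφ.continuousOn (2 * R)
  refine ⟨4 * C, fun z hz hd => (bregman_zero_le hφ.convexOn hz.1 hd).trans ?_⟩
  have hR : 0 ≤ R := hz.1.trans hz.2
  have h1 := abs_le.1 (hC 0 ⟨le_rfl, by linarith⟩)
  have h2 := abs_le.1 (hC z ⟨hz.1, by linarith [hz.2]⟩)
  have h3 := abs_le.1 (hC (2 * z) ⟨by linarith [hz.1], by linarith [hz.2]⟩)
  linarith

/-- A bound for `B(y, z)` with `z ≤ y` in a bounded interval, as long as `φ'(z)` stays bounded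
below. -/
theorem exists_bregman_above_bound (hc : ContinuousOn φ (Ici 0)) (R L : ℝ) :
    ∃ C, ∀ y z, 0 ≤ z → z ≤ y → y ≤ R → L ≤ dgen φ z → bregman φ y z ≤ C := by
  obtain ⟨C, hC0, hC⟩ := exists_bound_on_Icc hc R
  refine ⟨2 * C + |L| * R, fun y z hz hzy hy hL => ?_⟩
  have h1 := abs_le.1 (hC y ⟨hz.trans hzy, hy⟩)
  have h2 := abs_le.1 (hC z ⟨hz, hzy.trans hy⟩)
  have h3 : L * (y - z) ≤ dgen φ z * (y - z) :=
    mul_le_mul_of_nonneg_right hL (sub_nonneg.2 hzy)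
  have h4 : -(|L| * R) ≤ L * (y - z) := by
    have h5 : -|L| * (y - z) ≤ L * (y - z) :=
      mul_le_mul_of_nonneg_right (neg_abs_le L) (sub_nonneg.2 hzy)
    have h6 : |L| * (y - z) ≤ |L| * R :=
      mul_le_mul_of_nonneg_left (by linarith) (abs_nonneg L)
    linarith
  unfold bregman
  linarith

theorem IsBregmanGenerator.differentiableWithinAt (hφ : IsBregmanGenerator φ) {z : ℝ}
    (hz : 0 < z) : DifferentiableWithinAt ℝ φ (Ici 0) z :=
  ((hφ.contDiffOn.differentiableOn one_ne_zero).differentiableAt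
    (Ioi_mem_nhds hz)).differentiableWithinAt

theorem dgen_eq_deriv (φ : ℝ → ℝ) {z : ℝ} (hz : 0 < z) : dgen φ z = deriv φ z :=
  derivWithin_of_mem_nhds (Ici_mem_nhds hz)

theorem IsBregmanGenerator.continuousAt_dgen (hφ : IsBregmanGenerator φ) {z : ℝ} (hz : 0 < z) :
    ContinuousAt (dgen φ) z := by
  have h1 : ContinuousAt (deriv φ) z :=
    (hφ.contDiffOn.continuousOn_deriv_of_isOpen isOpen_Ioi le_rfl).continuousAt (Ioi_mem_nhds hz)
  refine h1.congr ?_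
  filter_upwards [Ioi_mem_nhds hz] with y hy
  exact (dgen_eq_deriv φ hy).symm

/-- Strong convexity bounds the divergence below by a quadratic, also at a second argument `0`
where `φ` is differentiable. -/
theorem sq_le_bregman (hφ : IsBregmanGenerator φ) {θ : ℝ}
    (hθ : ∀ z₁ z₂ : ℝ, 0 ≤ z₁ → 0 < z₂ →
      φ z₂ + dgen φ z₂ * (z₁ - z₂) + θ / 2 * (z₁ - z₂) ^ 2 ≤ φ z₁)
    {y z : ℝ} (hy : 0 ≤ y) (hz : 0 ≤ z) (hd : DifferentiableWithinAt ℝ φ (Ici 0) z) :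
    θ / 2 * (y - z) ^ 2 ≤ bregman φ y z := by
  rcases hz.eq_or_lt with rfl | hz
  · rcases hy.eq_or_lt with rfl | hy
    · simp [bregman]
    have h1 : ∀ᶠ x in 𝓝[>] (0 : ℝ),
        φ x + dgen φ 0 * (y - x) + θ / 2 * (y - x) ^ 2 ≤ φ y := by
      filter_upwards [Ioo_mem_nhdsGT hy] with x hx
      have h2 := hθ y x hy.le hx.1
      have h3 := mul_le_mul_of_nonneg_right
        (dgen_mono hφ.convexOn le_rfl hx.1.le hd (hφ.differentiableWithinAt hx.1))
        (sub_nonneg.2 hx.2.le)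
      linarith
    have h4 : Tendsto φ (𝓝[>] 0) (𝓝 (φ 0)) :=
      (hφ.continuousOn 0 self_mem_Ici).mono_left (nhdsWithin_mono _ Ioi_subset_Ici_self)
    have h5 : Tendsto (fun x : ℝ => x) (𝓝[>] 0) (𝓝 0) := nhdsWithin_le_nhds
    have h6 := (h4.add ((h5.const_sub y).const_mul (dgen φ 0))).add
      (((h5.const_sub y).pow 2).const_mul (θ / 2))
    have := le_of_tendsto h6 h1
    unfold bregman
    linarith
  · have := hθ y z hy hz
    unfold bregman
    linarith

/-- Strict convexity makes the divergence grow at least linearly, uniformly over second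
arguments in a bounded interval. -/
theorem exists_linear_le_bregman (hφ : IsBregmanGenerator φ) (hs : StrictConvexOn ℝ (Ici 0) φ)
    {M : ℝ} (hM : 0 < M) :
    ∃ κ > 0, ∀ y z, 0 ≤ y → z ∈ Icc 0 M → DifferentiableWithinAt ℝ φ (Ici 0) z →
      κ * (y - (M + 1)) ≤ bregman φ y z := by
  have hdM := hφ.differentiableWithinAt hM
  have hdM1 := hφ.differentiableWithinAt (show 0 < M + 1 by linarith)
  have hκ : dgen φ M < dgen φ (M + 1) :=
    (hs.derivWithin_lt_slope (mem_Ici.2 hM.le) (mem_Ici.2 (by linarith)) (lt_add_one M) hdM).trans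
      (hs.slope_lt_derivWithin (mem_Ici.2 hM.le) (mem_Ici.2 (by linarith)) (lt_add_one M) hdM1)
  refine ⟨dgen φ (M + 1) - dgen φ M, sub_pos.2 hκ, fun y z hy hz hd => ?_⟩
  rcases le_total y (M + 1) with h | h
  · exact (mul_nonpos_of_nonneg_of_nonpos (sub_pos.2 hκ).le (by linarith)).trans
      (bregman_nonneg hφ.convexOn hy hz.1 hd)
  · have h1 := bregman_nonneg hφ.convexOn hy (show 0 ≤ M + 1 by linarith) hdM1
    have h2 := bregman_nonneg hφ.convexOn (show 0 ≤ M + 1 by linarith) hz.1 hd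
    have h3 := mul_le_mul_of_nonneg_right (dgen_mono hφ.convexOn hz.1 hz.2 hd hdM)
      (sub_nonneg.2 h)
    unfold bregman at *
    linarith

end Bregman

/-! ### Utility functions -/

section Utility

variable {u : ℝ → ℝ}

theorem IsUtility.differentiableAt (hu : IsUtility u) {x : ℝ} (hx : 0 < x) :
    DifferentiableAt ℝ u x :=
  (hu.contDiffOn.differentiableOn two_ne_zero).differentiableAt (Ioi_mem_nhds hx)

theorem IsUtility.continuousOn_deriv (hu : IsUtility u) : ContinuousOn (deriv u) (Ioi 0) :=
  hu.contDiffOn.continuousOn_deriv_of_isOpen isOpen_Ioi one_le_two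

theorem IsUtility.strictAntiOn_deriv (hu : IsUtility u) : StrictAntiOn (deriv u) (Ioi 0) :=
  strictAntiOn_of_deriv_neg (convex_Ioi 0) hu.continuousOn_deriv fun x hx =>
    hu.deriv_deriv_neg x (by simpa using hx)

theorem IsUtility.strictConcaveOn (hu : IsUtility u) : StrictConcaveOn ℝ (Ici 0) u :=
  StrictAntiOn.strictConcaveOn_of_deriv (convex_Ici 0) hu.continuousOn
    (by simpa using hu.strictAntiOn_deriv)

theorem IsUtility.strictMonoOn (hu : IsUtility u) : StrictMonoOn u (Ici 0) :=
  strictMonoOn_of_deriv_pos (convex_Ici 0) hu.continuousOn fun x hx =>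
    hu.deriv_pos x (by simpa using hx)

/-- Marginal utility vanishing at infinity makes the utility sublinear. -/
theorem IsUtility.exists_le_linear (hu : IsUtility u) {δ : ℝ} (hδ : 0 < δ) :
    ∃ C, ∀ y, 0 ≤ y → u y ≤ δ * y + C := by
  obtain ⟨x, hxδ, hx⟩ :=
    ((hu.inada_top.eventually (gt_mem_nhds hδ)).and (eventually_gt_atTop 0)).exists
  refine ⟨u x, fun y hy => ?_⟩
  rcases le_or_gt y x with h | h
  · have := hu.strictMonoOn.monotoneOn hy hx.le h
    linarith [mul_nonneg hδ.le hy]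
  · have := hu.strictConcaveOn.concaveOn.slope_le_deriv (mem_Ici.2 hx.le) (mem_Ici.2 hy) h
      (hu.differentiableAt hx)
    rw [slope_def_field, div_le_iff₀ (sub_pos.2 h)] at this
    nlinarith

end Utility

/-! ### Feasibility in terms of Lebesgue integrals -/

theorem lintegral_ofReal_le_iff {α : Type*} [MeasurableSpace α] {μ : Measure α} {f : α → ℝ}
    (hf : AEStronglyMeasurable f μ) (h0 : 0 ≤ᵐ[μ] f) {c : ℝ} (hc : 0 ≤ c) :
    ∫⁻ a, ENNReal.ofReal (f a) ∂μ ≤ ENNReal.ofReal c ↔ Integrable f μ ∧ ∫ a, f a ∂μ ≤ c := by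
  constructor
  · intro h
    have hi : Integrable f μ :=
      ⟨hf, (hasFiniteIntegral_iff_ofReal h0).2 (h.trans_lt ENNReal.ofReal_lt_top)⟩
    rw [← ofReal_integral_eq_lintegral_ofReal hi h0, ENNReal.ofReal_le_ofReal_iff hc] at h
    exact ⟨hi, h⟩
  · rintro ⟨hi, h⟩
    rw [← ofReal_integral_eq_lintegral_ofReal hi h0]
    exact ENNReal.ofReal_le_ofReal h

/-- Monotone non-negative functions on `(0,1)`, without left-continuity. -/
structure IsNonnegMonotone (G : ℝ → ℝ) : Prop where
  nonneg : ∀ t ∈ Ioo (0 : ℝ) 1, 0 ≤ G t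
  monotoneOn : MonotoneOn G (Ioo 0 1)

theorem IsNonnegQuantile.isNonnegMonotone {G : ℝ → ℝ} (h : IsNonnegQuantile G) :
    IsNonnegMonotone G := ⟨h.nonneg, h.monotoneOn⟩

namespace IsNonnegMonotone

variable {G : ℝ → ℝ}

theorem aemeasurable (h : IsNonnegMonotone G) : AEMeasurable G (volume.restrict (Ioo 0 1)) :=
  aemeasurable_restrict_of_monotoneOn measurableSet_Ioo h.monotoneOn

theorem ae_nonneg (h : IsNonnegMonotone G) : ∀ᵐ t ∂(volume.restrict (Ioo (0 : ℝ) 1)), 0 ≤ G t :=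
  (ae_restrict_mem measurableSet_Ioo).mono h.nonneg

theorem aestronglyMeasurable_comp (h : IsNonnegMonotone G) {g : ℝ → ℝ}
    (hg : ContinuousOn g (Ici 0)) :
    AEStronglyMeasurable (fun t => g (G t)) (volume.restrict (Ioo 0 1)) := by
  have hc : Continuous fun y : ℝ => g (max y 0) :=
    hg.comp_continuous (continuous_id.max continuous_const) fun x =>
      mem_Ici.2 (le_max_right _ _)
  refine (hc.measurable.comp_aemeasurable h.aemeasurable).aestronglyMeasurable.congr ?_
  filter_upwards [h.ae_nonneg] with t ht
  simp [max_eq_left ht]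

/-- A monotone function on `(0,1)` agrees almost everywhere with a left-continuous one. -/
theorem exists_quantile (h : IsNonnegMonotone G) :
    ∃ H, IsNonnegQuantile H ∧ (∀ t ∈ Ioo (0 : ℝ) 1, H t ≤ G t) ∧
      H =ᵐ[volume.restrict (Ioo 0 1)] G := by
  let H : ℝ → ℝ := fun t => sSup (G '' Ioo 0 t)
  have hne : ∀ t ∈ Ioo (0 : ℝ) 1, (G '' Ioo 0 t).Nonempty := fun t ht =>
    (nonempty_Ioo.2 ht.1).image G
  have hub : ∀ t ∈ Ioo (0 : ℝ) 1, ∀ y ∈ G '' Ioo 0 t, y ≤ G t := by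
    rintro t ht _ ⟨s, hs, rfl⟩
    exact h.monotoneOn ⟨hs.1, hs.2.trans ht.2⟩ ht hs.2.le
  have hbdd : ∀ t ∈ Ioo (0 : ℝ) 1, BddAbove (G '' Ioo 0 t) := fun t ht => ⟨G t, hub t ht⟩
  have hle : ∀ t ∈ Ioo (0 : ℝ) 1, H t ≤ G t := fun t ht => csSup_le (hne t ht) (hub t ht)
  have hge : ∀ t ∈ Ioo (0 : ℝ) 1, ∀ s ∈ Ioo 0 t, G s ≤ H t := fun t ht s hs =>
    le_csSup (hbdd t ht) (mem_image_of_mem G hs)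
  have hmono : MonotoneOn H (Ioo 0 1) := fun s hs t ht hst =>
    csSup_le_csSup (hbdd t ht) (hne s hs) (image_mono (Ioo_subset_Ioo_right hst))
  refine ⟨H, ⟨fun t ht => ?_, hmono, fun t ht => ?_⟩, hle, ?_⟩
  · have hs : t / 2 ∈ Ioo 0 t := ⟨by linarith [ht.1], by linarith [ht.1]⟩
    exact (h.nonneg _ ⟨hs.1, hs.2.trans ht.2⟩).trans (hge t ht _ hs)
  · refine tendsto_order.2 ⟨fun a ha => ?_, fun a ha => ?_⟩
    · obtain ⟨_, ⟨s, hs, rfl⟩, has⟩ := exists_lt_of_lt_csSup (hne t ht) ha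
      filter_upwards [mem_nhdsWithin_of_mem_nhds (Ioo_mem_nhds hs.2 ht.2)] with v hv
      exact has.trans_le (hge v ⟨hs.1.trans hv.1, hv.2⟩ s ⟨hs.1, hv.1⟩)
    · filter_upwards [mem_nhdsWithin_of_mem_nhds (Ioo_mem_nhds ht.1 ht.2), self_mem_nhdsWithin]
        with v hv hvt
      exact (hmono hv ht hvt).trans_lt ha
  · have hcount := h.monotoneOn.countable_not_continuousWithinAt
    have hnull := hcount.ae_notMem (volume.restrict (Ioo (0 : ℝ) 1))
    filter_upwards [hnull, ae_restrict_mem measurableSet_Ioo] with t ht htI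
    have hc : ContinuousWithinAt G (Ioo 0 1) t := by
      by_contra hcon
      exact ht ⟨htI, hcon⟩
    have hc' : Tendsto G (𝓝[<] t) (𝓝 (G t)) :=
      (hc.continuousAt (Ioo_mem_nhds htI.1 htI.2)).mono_left nhdsWithin_le_nhds
    refine le_antisymm (hle t htI) (le_of_tendsto hc' ?_)
    filter_upwards [Ioo_mem_nhdsLT htI.1] with s hs
    exact hge t htI s hs

end IsNonnegMonotone

theorem IsNonnegQuantile.leftCont' {G : ℝ → ℝ} (h : IsNonnegQuantile G) {t : ℝ}
    (ht : t ∈ Ioo (0 : ℝ) 1) : Tendsto G (𝓝[<] t) (𝓝 (G t)) :=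
  (h.leftCont t ht).mono_left (nhdsWithin_mono _ Iio_subset_Iic_self)

/-- A property that holds almost everywhere on `(a, t)` holds at points accumulating at `t` from
the left. -/
theorem frequently_nhdsLT_of_ae {P : ℝ → Prop} {a t : ℝ} (hat : a < t)
    (h : ∀ᵐ s ∂(volume.restrict (Ioo a t)), P s) : ∃ᶠ s in 𝓝[<] t, P s := by
  intro hnot
  obtain ⟨c, hc, hct⟩ := (mem_nhdsLT_iff_exists_Ioo_subset' hat).1 hnot
  have hne : (volume.restrict (Ioo a t)) (Ioo (max a c) t) ≠ 0 := by
    rw [Measure.restrict_apply measurableSet_Ioo, inter_eq_left.2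
      (Ioo_subset_Ioo_left (le_max_left _ _))]
    have : max a c < t := max_lt hat hc
    simpa using this
  refine hne (measure_mono_null (fun s hs => ?_) (ae_iff.1 h))
  exact hct ⟨(le_max_right _ _).trans_lt hs.1, hs.2⟩

/-- Left-continuous functions that agree almost everywhere on `(0,1)` agree everywhere there. -/
theorem IsNonnegQuantile.eqOn_of_ae {G H : ℝ → ℝ} (hG : IsNonnegQuantile G)
    (hH : IsNonnegQuantile H) (h : G =ᵐ[volume.restrict (Ioo 0 1)] H) :
    EqOn G H (Ioo 0 1) := fun t ht => by
  have hfreq := frequently_nhdsLT_of_ae ht.1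
    (ae_restrict_of_ae_restrict_of_subset (Ioo_subset_Ioo_right ht.2.le) h)
  have := tendsto_nhds_unique_of_frequently_eq (hG.leftCont' ht) (hH.leftCont' ht) hfreq
  exact this

theorem IsNonnegQuantile.convexComb {G H : ℝ → ℝ} (hG : IsNonnegQuantile G)
    (hH : IsNonnegQuantile H) {a b : ℝ} (ha : 0 ≤ a) (hb : 0 ≤ b) :
    IsNonnegQuantile fun t => a * G t + b * H t where
  nonneg t ht := add_nonneg (mul_nonneg ha (hG.nonneg t ht)) (mul_nonneg hb (hH.nonneg t ht))
  monotoneOn _ hs _ ht hst := add_le_add (mul_le_mul_of_nonneg_left (hG.monotoneOn hs ht hst) ha)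
    (mul_le_mul_of_nonneg_left (hH.monotoneOn hs ht hst) hb)
  leftCont t ht := ((hG.leftCont t ht).const_mul a).add ((hH.leftCont t ht).const_mul b)

/-- The properties shared by the classes of integrable and of square-integrable quantile
functions: all that the first-order analysis uses. -/
structure IsQuantileClass (𝒞 : Set (ℝ → ℝ)) : Prop where
  quantile : ∀ G ∈ 𝒞, IsNonnegQuantile G
  integrable : ∀ G ∈ 𝒞, IntegrableOn G (Ioo 0 1)
  dominated : ∀ G ∈ 𝒞, ∀ n : ℝ, ∀ H, IsNonnegQuantile H → (∀ t ∈ Ioo (0 : ℝ) 1, H t ≤ G t + n) →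
    H ∈ 𝒞
  convexComb : ∀ G ∈ 𝒞, ∀ H ∈ 𝒞, ∀ a b : ℝ, 0 ≤ a → 0 ≤ b → a + b = 1 →
    (fun t => a * G t + b * H t) ∈ 𝒞

theorem isQuantileClass_L1 : IsQuantileClass quantilesL1 where
  quantile _ h := h.1
  integrable _ h := h.2
  dominated G hG n H hH h := by
    refine ⟨hH, (hG.2.add (integrable_const n)).mono'
      hH.isNonnegMonotone.aemeasurable.aestronglyMeasurable ?_⟩
    filter_upwards [ae_restrict_mem measurableSet_Ioo] with t ht
    simpa [abs_of_nonneg (hH.nonneg t ht)] using h t ht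
  convexComb G hG H hH a b ha hb _ :=
    ⟨hG.1.convexComb hH.1 ha hb, (hG.2.const_mul a).add (hH.2.const_mul b)⟩

theorem memLp_of_mem_quantilesL2 {G : ℝ → ℝ} (h : G ∈ quantilesL2) :
    MemLp G 2 (volume.restrict (Ioo 0 1)) :=
  (memLp_two_iff_integrable_sq h.1.isNonnegMonotone.aemeasurable.aestronglyMeasurable).2 h.2

theorem isQuantileClass_L2 : IsQuantileClass quantilesL2 where
  quantile _ h := h.1
  integrable _ h := (memLp_of_mem_quantilesL2 h).integrable one_le_two
  dominated G hG n H hH h := by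
    have hm := hH.isNonnegMonotone.aemeasurable.aestronglyMeasurable
    refine ⟨hH, (memLp_two_iff_integrable_sq hm).1 ?_⟩
    refine ((memLp_of_mem_quantilesL2 hG).add (memLp_const n)).mono' (g := fun t => G t + n) hm ?_
    filter_upwards [ae_restrict_mem measurableSet_Ioo] with t ht
    simpa [abs_of_nonneg (hH.nonneg t ht)] using h t ht
  convexComb G hG H hH a b ha hb _ := by
    have hq := hG.1.convexComb hH.1 ha hb
    refine ⟨hq, (memLp_two_iff_integrable_sq
      hq.isNonnegMonotone.aemeasurable.aestronglyMeasurable).1 ?_⟩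
    exact ((memLp_of_mem_quantilesL2 hG).const_mul a).add
      ((memLp_of_mem_quantilesL2 hH).const_mul b)

theorem quantilesL2_subset_quantilesL1 : quantilesL2 ⊆ quantilesL1 := fun G hG =>
  ⟨hG.1, isQuantileClass_L2.integrable G hG⟩

/-- What the analysis uses about the generator `φ`, the quantile function `p` of the state price
density and the quantile function `Fb` of the benchmark. -/
structure IsMarket (φ p Fb : ℝ → ℝ) : Prop where
  generator : IsBregmanGenerator φ
  benchmark : IsNonnegQuantile Fb
  differentiable : ∀ t ∈ Ioo (0 : ℝ) 1, DifferentiableWithinAt ℝ φ (Ici 0) (Fb t)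
  price_pos : ∀ t ∈ Ioo (0 : ℝ) 1, 0 < p t
  price_mono : MonotoneOn p (Ioo 0 1)
  price_integrable : IntegrableOn (fun t => p (1 - t)) (Ioo 0 1)

theorem one_sub_mem_Ioo {t : ℝ} (ht : t ∈ Ioo (0 : ℝ) 1) : 1 - t ∈ Ioo (0 : ℝ) 1 :=
  ⟨by linarith [ht.2], by linarith [ht.1]⟩

/-- The members of `𝒞` with finite divergence from the benchmark and finite cost. -/
structure IsAdmissible (𝒞 : Set (ℝ → ℝ)) (φ p Fb G : ℝ → ℝ) : Prop where
  mem : G ∈ 𝒞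
  div : IntegrableOn (fun t => bregman φ (G t) (Fb t)) (Ioo 0 1)
  cost : IntegrableOn (fun t => G t * p (1 - t)) (Ioo 0 1)

/-- The divergence from the benchmark as a Bochner integral. -/
noncomputable def divInt (φ Fb G : ℝ → ℝ) : ℝ := ∫ t in Ioo (0 : ℝ) 1, bregman φ (G t) (Fb t)

/-- The cost as a Bochner integral. -/
noncomputable def costInt (p G : ℝ → ℝ) : ℝ := ∫ t in Ioo (0 : ℝ) 1, G t * p (1 - t)

namespace IsMarket

variable {φ p Fb : ℝ → ℝ} {G : ℝ → ℝ} {𝒞 : Set (ℝ → ℝ)}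

theorem monotoneOn_dgen (hM : IsMarket φ p Fb) :
    MonotoneOn (fun t => dgen φ (Fb t)) (Ioo 0 1) := fun s hs t ht hst =>
  dgen_mono hM.generator.convexOn (hM.benchmark.nonneg s hs) (hM.benchmark.monotoneOn hs ht hst)
    (hM.differentiable s hs) (hM.differentiable t ht)

theorem bregman_nonneg (hM : IsMarket φ p Fb) {y t : ℝ} (hy : 0 ≤ y) (ht : t ∈ Ioo (0 : ℝ) 1) :
    0 ≤ bregman φ y (Fb t) :=
  BWPortfolio.bregman_nonneg hM.generator.convexOn hy (hM.benchmark.nonneg t ht)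
    (hM.differentiable t ht)

theorem aestronglyMeasurable_bregman (hM : IsMarket φ p Fb) (hG : IsNonnegMonotone G) :
    AEStronglyMeasurable (fun t => bregman φ (G t) (Fb t)) (volume.restrict (Ioo 0 1)) := by
  have hb := hM.benchmark.isNonnegMonotone
  have hd : AEStronglyMeasurable (fun t => dgen φ (Fb t)) (volume.restrict (Ioo (0 : ℝ) 1)) :=
    (aemeasurable_restrict_of_monotoneOn measurableSet_Ioo hM.monotoneOn_dgen).aestronglyMeasurable
  exact ((hG.aestronglyMeasurable_comp hM.generator.continuousOn).sub
    (hb.aestronglyMeasurable_comp hM.generator.continuousOn)).sub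
    (hd.mul (hG.aemeasurable.aestronglyMeasurable.sub hb.aemeasurable.aestronglyMeasurable))

theorem aestronglyMeasurable_cost (hM : IsMarket φ p Fb) (hG : IsNonnegMonotone G) :
    AEStronglyMeasurable (fun t => G t * p (1 - t)) (volume.restrict (Ioo 0 1)) :=
  hG.aemeasurable.aestronglyMeasurable.mul hM.price_integrable.1

theorem ae_bregman_nonneg (hM : IsMarket φ p Fb) (hG : IsNonnegMonotone G) :
    0 ≤ᵐ[volume.restrict (Ioo 0 1)] fun t => bregman φ (G t) (Fb t) :=
  (ae_restrict_mem measurableSet_Ioo).mono fun t ht => hM.bregman_nonneg (hG.nonneg t ht) ht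

theorem ae_cost_nonneg (hM : IsMarket φ p Fb) (hG : IsNonnegMonotone G) :
    0 ≤ᵐ[volume.restrict (Ioo 0 1)] fun t => G t * p (1 - t) :=
  (ae_restrict_mem measurableSet_Ioo).mono fun t ht =>
    mul_nonneg (hG.nonneg t ht) (hM.price_pos _ (one_sub_mem_Ioo ht)).le

theorem toReal_bwDiv (hM : IsMarket φ p Fb) (hG : IsNonnegMonotone G) :
    (bwDiv φ G Fb).toReal = divInt φ Fb G :=
  (integral_eq_lintegral_of_nonneg_ae (hM.ae_bregman_nonneg hG)
    (hM.aestronglyMeasurable_bregman hG)).symm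

theorem toReal_cost (hM : IsMarket φ p Fb) (hG : IsNonnegMonotone G) :
    (BWPortfolio.cost p G).toReal = costInt p G :=
  (integral_eq_lintegral_of_nonneg_ae (hM.ae_cost_nonneg hG)
    (hM.aestronglyMeasurable_cost hG)).symm

theorem mem_feasible_iff (hM : IsMarket φ p Fb) (h𝒞 : IsQuantileClass 𝒞) {x₀ ε : ℝ}
    (hx₀ : 0 ≤ x₀) (hε : 0 ≤ ε) :
    G ∈ feasible 𝒞 φ p Fb x₀ ε ↔
      IsAdmissible 𝒞 φ p Fb G ∧ divInt φ Fb G ≤ ε ∧ costInt p G ≤ x₀ := by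
  constructor
  · rintro ⟨h1, h2, h3⟩
    have hG := (h𝒞.quantile G h1).isNonnegMonotone
    have h2' := (lintegral_ofReal_le_iff (hM.aestronglyMeasurable_bregman hG)
      (hM.ae_bregman_nonneg hG) hε).1 h2
    have h3' := (lintegral_ofReal_le_iff (hM.aestronglyMeasurable_cost hG)
      (hM.ae_cost_nonneg hG) hx₀).1 h3
    exact ⟨⟨h1, h2'.1, h3'.1⟩, h2'.2, h3'.2⟩
  · rintro ⟨⟨h1, h2, h3⟩, h4, h5⟩
    have hG := (h𝒞.quantile G h1).isNonnegMonotone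
    exact ⟨h1, (lintegral_ofReal_le_iff (hM.aestronglyMeasurable_bregman hG)
      (hM.ae_bregman_nonneg hG) hε).2 ⟨h2, h4⟩,
      (lintegral_ofReal_le_iff (hM.aestronglyMeasurable_cost hG)
      (hM.ae_cost_nonneg hG) hx₀).2 ⟨h3, h5⟩⟩

/-- Finite cost is automatic below an admissible function plus a constant, because the state
price density is integrable. -/
theorem integrable_cost_of_le (hM : IsMarket φ p Fb) {H : ℝ → ℝ}
    (hG : IntegrableOn (fun t => G t * p (1 - t)) (Ioo 0 1)) (hH : IsNonnegMonotone H) (n : ℝ)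
    (h : ∀ t ∈ Ioo (0 : ℝ) 1, H t ≤ G t + n) :
    IntegrableOn (fun t => H t * p (1 - t)) (Ioo 0 1) := by
  refine (hG.add (hM.price_integrable.const_mul n)).mono' (hM.aestronglyMeasurable_cost hH) ?_
  filter_upwards [ae_restrict_mem measurableSet_Ioo] with t ht
  have hp := (hM.price_pos _ (one_sub_mem_Ioo ht)).le
  rw [Real.norm_eq_abs, abs_of_nonneg (mul_nonneg (hH.nonneg t ht) hp)]
  have := mul_le_mul_of_nonneg_right (h t ht) hp
  simp only [Pi.add_apply]
  linarith

theorem integrable_div_of_le (hM : IsMarket φ p Fb) {H : ℝ → ℝ}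
    (hG : IntegrableOn (fun t => bregman φ (G t) (Fb t)) (Ioo 0 1)) (hH : IsNonnegMonotone H)
    (C : ℝ) (h : ∀ t ∈ Ioo (0 : ℝ) 1, bregman φ (H t) (Fb t) ≤ bregman φ (G t) (Fb t) + C) :
    IntegrableOn (fun t => bregman φ (H t) (Fb t)) (Ioo 0 1) := by
  refine (hG.add (integrable_const C)).mono' (hM.aestronglyMeasurable_bregman hH) ?_
  filter_upwards [ae_restrict_mem measurableSet_Ioo] with t ht
  rw [Real.norm_eq_abs, abs_of_nonneg (hM.bregman_nonneg (hH.nonneg t ht) ht)]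
  exact h t ht

theorem isAdmissible_convexComb (hM : IsMarket φ p Fb) (h𝒞 : IsQuantileClass 𝒞) {H : ℝ → ℝ}
    (hG : IsAdmissible 𝒞 φ p Fb G) (hH : IsAdmissible 𝒞 φ p Fb H) {a b : ℝ} (ha : 0 ≤ a)
    (hb : 0 ≤ b) (hab : a + b = 1) :
    IsAdmissible 𝒞 φ p Fb (fun t => a * G t + b * H t) ∧
      divInt φ Fb (fun t => a * G t + b * H t) ≤ a * divInt φ Fb G + b * divInt φ Fb H ∧
      costInt p (fun t => a * G t + b * H t) = a * costInt p G + b * costInt p H := by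
  have hGq := (h𝒞.quantile G hG.mem).isNonnegMonotone
  have hHq := (h𝒞.quantile H hH.mem).isNonnegMonotone
  have hK := h𝒞.convexComb G hG.mem H hH.mem a b ha hb hab
  have hKq := (h𝒞.quantile _ hK).isNonnegMonotone
  have hle : ∀ t ∈ Ioo (0 : ℝ) 1, bregman φ (a * G t + b * H t) (Fb t) ≤
      a * bregman φ (G t) (Fb t) + b * bregman φ (H t) (Fb t) := fun t ht =>
    (bregman_convex_left hM.generator.convexOn (Fb t)).2 (mem_Ici.2 (hGq.nonneg t ht))
      (mem_Ici.2 (hHq.nonneg t ht)) ha hb hab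
  have hsum := (hG.div.const_mul a).add (hH.div.const_mul b)
  have hdiv : IntegrableOn (fun t => bregman φ (a * G t + b * H t) (Fb t)) (Ioo 0 1) := by
    refine hsum.mono' (hM.aestronglyMeasurable_bregman hKq) ?_
    filter_upwards [ae_restrict_mem measurableSet_Ioo] with t ht
    rw [Real.norm_eq_abs, abs_of_nonneg (hM.bregman_nonneg (hKq.nonneg t ht) ht)]
    exact hle t ht
  have hcost : (fun t => (a * G t + b * H t) * p (1 - t)) =
      fun t => a * (G t * p (1 - t)) + b * (H t * p (1 - t)) := by
    ext t; ring
  refine ⟨⟨hK, hdiv, ?_⟩, ?_, ?_⟩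
  · rw [hcost]
    exact (hG.cost.const_mul a).add (hH.cost.const_mul b)
  · refine (integral_mono_ae hdiv hsum
      ((ae_restrict_mem measurableSet_Ioo).mono hle)).trans_eq ?_
    simp only [Pi.add_apply]
    rw [integral_add (hG.div.const_mul a) (hH.div.const_mul b), integral_const_mul,
      integral_const_mul]
    rfl
  · unfold costInt
    rw [hcost, integral_add (hG.cost.const_mul a) (hH.cost.const_mul b), integral_const_mul,
      integral_const_mul]

end IsMarket

/-! ### Expected utility -/

section ExpectedUtility

variable {u : ℝ → ℝ} {G H : ℝ → ℝ}

theorem IsUtility.integrable_comp (hu : IsUtility u) (hG : IsNonnegMonotone G)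
    (hi : IntegrableOn G (Ioo 0 1)) : IntegrableOn (fun t => u (G t)) (Ioo 0 1) := by
  obtain ⟨C, hC⟩ := hu.exists_le_linear one_pos
  refine (hi.add (integrable_const (|C| + |u 0|))).mono'
    (hG.aestronglyMeasurable_comp hu.continuousOn) ?_
  filter_upwards [ae_restrict_mem measurableSet_Ioo] with t ht
  have h0 := hG.nonneg t ht
  have h1 := hC _ h0
  have h2 := hu.strictMonoOn.monotoneOn self_mem_Ici (mem_Ici.2 h0) h0
  have h3 := le_abs_self C
  have h4 := neg_abs_le (u 0)
  have h5 := abs_nonneg C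
  have h6 := abs_nonneg (u 0)
  rw [Real.norm_eq_abs, abs_le]
  constructor <;> simp only [Pi.add_apply] <;> linarith

theorem IsUtility.le_expectedUtility_convexComb (hu : IsUtility u) (hG : IsNonnegQuantile G)
    (hH : IsNonnegQuantile H) (hGi : IntegrableOn G (Ioo 0 1)) (hHi : IntegrableOn H (Ioo 0 1))
    {a b : ℝ} (ha : 0 ≤ a) (hb : 0 ≤ b) (hab : a + b = 1) :
    a * expectedUtility u G + b * expectedUtility u H ≤
      expectedUtility u (fun t => a * G t + b * H t) := by
  have h1 := (hu.integrable_comp hG.isNonnegMonotone hGi).const_mul a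
  have h2 := (hu.integrable_comp hH.isNonnegMonotone hHi).const_mul b
  have h3 := hu.integrable_comp (hG.convexComb hH ha hb).isNonnegMonotone
    ((hGi.const_mul a).add (hHi.const_mul b))
  unfold expectedUtility
  rw [← integral_const_mul, ← integral_const_mul, ← integral_add h1 h2]
  refine integral_mono_ae (h1.add h2) h3 ?_
  filter_upwards [ae_restrict_mem measurableSet_Ioo] with t ht
  exact hu.strictConcaveOn.concaveOn.2 (mem_Ici.2 (hG.nonneg t ht)) (mem_Ici.2 (hH.nonneg t ht))
    ha hb hab

/-- If the midpoint is not better than two equally good functions, strict concavity makes them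
coincide. -/
theorem IsUtility.eqOn_of_expectedUtility_midpoint_le (hu : IsUtility u) (hG : IsNonnegQuantile G)
    (hH : IsNonnegQuantile H) (hGi : IntegrableOn G (Ioo 0 1)) (hHi : IntegrableOn H (Ioo 0 1))
    (hle : expectedUtility u (fun t => 1 / 2 * G t + 1 / 2 * H t) ≤
      1 / 2 * expectedUtility u G + 1 / 2 * expectedUtility u H) : EqOn G H (Ioo 0 1) := by
  have h1 := (hu.integrable_comp hG.isNonnegMonotone hGi).const_mul (1 / 2)
  have h2 := (hu.integrable_comp hH.isNonnegMonotone hHi).const_mul (1 / 2)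
  have hhalf : (0 : ℝ) ≤ 1 / 2 := by norm_num
  have h3 := hu.integrable_comp (hG.convexComb hH hhalf hhalf).isNonnegMonotone
    ((hGi.const_mul _).add (hHi.const_mul _))
  have hae : ∀ᵐ t ∂(volume.restrict (Ioo (0 : ℝ) 1)),
      1 / 2 * u (G t) + 1 / 2 * u (H t) ≤ u (1 / 2 * G t + 1 / 2 * H t) := by
    filter_upwards [ae_restrict_mem measurableSet_Ioo] with t ht
    exact hu.strictConcaveOn.concaveOn.2 (mem_Ici.2 (hG.nonneg t ht))
      (mem_Ici.2 (hH.nonneg t ht)) hhalf hhalf (by norm_num)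
  have heq : ∫ t in Ioo (0 : ℝ) 1, (1 / 2 * u (G t) + 1 / 2 * u (H t)) =
      ∫ t in Ioo (0 : ℝ) 1, u (1 / 2 * G t + 1 / 2 * H t) := by
    refine le_antisymm (integral_mono_ae (h1.add h2) h3 hae) (hle.trans_eq ?_)
    unfold expectedUtility
    rw [← integral_const_mul, ← integral_const_mul, ← integral_add h1 h2]
  have hpt := (integral_eq_iff_of_ae_le (h1.add h2) h3 hae).1 heq
  refine hG.eqOn_of_ae hH ?_
  filter_upwards [hpt, ae_restrict_mem measurableSet_Ioo] with t ht htI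
  by_contra hne
  have := hu.strictConcaveOn.2 (mem_Ici.2 (hG.nonneg t htI)) (mem_Ici.2 (hH.nonneg t htI)) hne
    (show (0 : ℝ) < 1 / 2 by norm_num) (show (0 : ℝ) < 1 / 2 by norm_num) (by norm_num)
  exact absurd ht this.ne

end ExpectedUtility

theorem IsMarket.isUniqueSolution {φ p Fb u : ℝ → ℝ} {𝒞 : Set (ℝ → ℝ)} {x₀ ε : ℝ} {F : ℝ → ℝ}
    (hM : IsMarket φ p Fb) (h𝒞 : IsQuantileClass 𝒞) (hu : IsUtility u) (hx₀ : 0 ≤ x₀)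
    (hε : 0 ≤ ε) (hF : Solves 𝒞 u φ p Fb x₀ ε F) : IsUniqueSolution 𝒞 u φ p Fb x₀ ε F := by
  refine ⟨hF, fun G hG => ?_⟩
  obtain ⟨hFa, hFd, hFc⟩ := (hM.mem_feasible_iff h𝒞 hx₀ hε).1 hF.1
  obtain ⟨hGa, hGd, hGc⟩ := (hM.mem_feasible_iff h𝒞 hx₀ hε).1 hG.1
  have hhalf : (0 : ℝ) ≤ 1 / 2 := by norm_num
  obtain ⟨h1, h2, h3⟩ := hM.isAdmissible_convexComb h𝒞 hGa hFa hhalf hhalf (by norm_num)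
  have hmem := (hM.mem_feasible_iff h𝒞 hx₀ hε).2 ⟨h1, by linarith, by linarith⟩
  have hFU := isMaxOn_iff.1 hF.2 _ hmem
  have hGU := isMaxOn_iff.1 hG.2 _ hmem
  exact hu.eqOn_of_expectedUtility_midpoint_le (h𝒞.quantile _ hGa.mem) (h𝒞.quantile _ hFa.mem)
    (h𝒞.integrable _ hGa.mem) (h𝒞.integrable _ hFa.mem) (by linarith)

/-! ### Lagrange multipliers -/

theorem nonneg_of_forall_affine_pos {a b : ℝ} (h : ∀ N, 0 ≤ N → 0 < a * N + b) : 0 ≤ a := by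
  by_contra! ha
  have hb := h 0 le_rfl
  have := h (b / -a) (div_nonneg (by linarith) (by linarith))
  rw [mul_div_assoc', div_neg, mul_div_cancel_left₀ _ ha.ne] at this
  linarith

/-- Setting a quantile function to `0` near the left end of `(0,1)`. -/
theorem IsNonnegQuantile.indicator_Ioi {G : ℝ → ℝ} (hG : IsNonnegQuantile G) (s : ℝ) :
    IsNonnegQuantile ((Ioi s).indicator G) where
  nonneg t ht := by
    by_cases h : t ∈ Ioi s
    · rw [indicator_of_mem h]
      exact hG.nonneg t ht
    · rw [indicator_of_notMem h]
  monotoneOn a ha b hb hab := by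
    by_cases h : a ∈ Ioi s
    · rw [indicator_of_mem h, indicator_of_mem (mem_Ioi.2 (lt_of_lt_of_le h hab))]
      exact hG.monotoneOn ha hb hab
    · rw [indicator_of_notMem h]
      exact indicator_apply_nonneg fun _ => hG.nonneg b hb
  leftCont t ht := by
    by_cases h : t ∈ Ioi s
    · refine (hG.leftCont t ht).congr_of_eventuallyEq ?_ (indicator_of_mem h _)
      filter_upwards [mem_nhdsWithin_of_mem_nhds (Ioi_mem_nhds h)] with a ha
      exact indicator_of_mem ha _
    · refine ContinuousWithinAt.congr (f := fun _ => (0 : ℝ)) continuousWithinAt_const (fun a ha => ?_) (indicator_of_notMem h _)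
      exact indicator_of_notMem (fun hs => h (lt_of_lt_of_le hs ha)) _

/-- The Slater condition for the divergence constraint implies the one for both constraints.
Lowering the given function to `0` on `(0, s]` strictly reduces the cost and keeps the divergence
finite, since the benchmark is bounded there; a small step towards the lowered function then
satisfies both constraints strictly. -/
theorem IsMarket.exists_strictly_feasible {φ p Fb G : ℝ → ℝ} {𝒞 : Set (ℝ → ℝ)} {x₀ ε : ℝ}
    (hM : IsMarket φ p Fb) (h𝒞 : IsQuantileClass 𝒞) (hx₀ : 0 < x₀)
    (hG : IsAdmissible 𝒞 φ p Fb G) (hdiv : divInt φ Fb G < ε) (hcost : costInt p G ≤ x₀) :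
    ∃ K, IsAdmissible 𝒞 φ p Fb K ∧ divInt φ Fb K < ε ∧ costInt p K < x₀ := by
  have hGq := h𝒞.quantile G hG.mem
  by_cases hzero : ∀ t ∈ Ioo (0 : ℝ) 1, G t = 0
  · refine ⟨G, hG, hdiv, ?_⟩
    have : costInt p G = 0 := by
      unfold costInt
      rw [setIntegral_congr_fun (g := fun _ => 0) measurableSet_Ioo
        fun t ht => by simp [hzero t ht]]
      simp
    linarith
  push Not at hzero
  obtain ⟨s, hs, hGs⟩ := hzero
  set H := (Ioi s).indicator G with hHdef
  have hHq : IsNonnegQuantile H := hGq.indicator_Ioi s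
  have hHG : ∀ t ∈ Ioo (0 : ℝ) 1, H t ≤ G t := fun t ht =>
    indicator_apply_le' (fun _ => le_rfl) fun _ => hGq.nonneg t ht
  obtain ⟨C, hC⟩ := exists_bregman_zero_bound hM.generator (Fb s)
  have hHadm : IsAdmissible 𝒞 φ p Fb H := by
    refine ⟨h𝒞.dominated G hG.mem 0 H hHq fun t ht => by simpa using hHG t ht,
      hM.integrable_div_of_le hG.div hHq.isNonnegMonotone (max C 0) fun t ht => ?_,
      hM.integrable_cost_of_le hG.cost hHq.isNonnegMonotone 0
        fun t ht => by simpa using hHG t ht⟩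
    have hb := hM.bregman_nonneg (hGq.nonneg t ht) ht
    by_cases h : t ∈ Ioi s
    · rw [hHdef, indicator_of_mem h]
      linarith [le_max_right C 0]
    · rw [hHdef, indicator_of_notMem h]
      have := hC (Fb t) ⟨hM.benchmark.nonneg t ht, hM.benchmark.monotoneOn ht hs (not_lt.1 h)⟩
        (hM.differentiable t ht)
      linarith [le_max_left C 0]
  have hle : ∀ᵐ t ∂(volume.restrict (Ioo (0 : ℝ) 1)), H t * p (1 - t) ≤ G t * p (1 - t) := by
    filter_upwards [ae_restrict_mem measurableSet_Ioo] with t ht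
    exact mul_le_mul_of_nonneg_right (hHG t ht) (hM.price_pos _ (one_sub_mem_Ioo ht)).le
  have hlt : costInt p H < costInt p G := by
    refine lt_of_le_of_ne (integral_mono_ae hHadm.cost hG.cost hle) fun heq => hGs ?_
    have hae := (integral_eq_iff_of_ae_le hHadm.cost hG.cost hle).1 heq
    have hfreq : ∃ᶠ t in 𝓝[<] s, G t = 0 := by
      refine frequently_nhdsLT_of_ae hs.1 ?_
      filter_upwards [ae_restrict_of_ae_restrict_of_subset (Ioo_subset_Ioo_right hs.2.le) hae,
        ae_restrict_mem measurableSet_Ioo] with t ht htI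
      have hp := hM.price_pos _ (one_sub_mem_Ioo ⟨htI.1, htI.2.trans hs.2⟩)
      have hH0 : H t = 0 := indicator_of_notMem (not_lt.2 htI.2.le) _
      rw [hH0, zero_mul] at ht
      exact (mul_eq_zero.1 ht.symm).resolve_right hp.ne'
    exact tendsto_nhds_unique_of_frequently_eq (hGq.leftCont' hs) tendsto_const_nhds hfreq
  have hlim : Tendsto (fun δ : ℝ => (1 - δ) * divInt φ Fb G + δ * divInt φ Fb H) (𝓝[>] 0)
      (𝓝 (divInt φ Fb G)) := by
    have : Continuous fun δ : ℝ => (1 - δ) * divInt φ Fb G + δ * divInt φ Fb H := by fun_prop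
    simpa using (this.tendsto 0).mono_left nhdsWithin_le_nhds
  obtain ⟨δ, hδε, hδ⟩ :=
    ((hlim.eventually (gt_mem_nhds hdiv)).and (Ioo_mem_nhdsGT one_pos)).exists
  obtain ⟨h1, h2, h3⟩ := hM.isAdmissible_convexComb h𝒞 hG hHadm (sub_nonneg.2 hδ.2.le) hδ.1.le
    (sub_add_cancel 1 δ)
  refine ⟨_, h1, h2.trans_lt hδε, ?_⟩
  rw [h3]
  have := mul_lt_mul_of_pos_left hlt hδ.1
  linarith

/-- Karush–Kuhn–Tucker multipliers. The set of triples that dominate (cost excess, divergence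
excess, utility deficit) of some admissible function is open and convex and misses the origin;
the normal of a separating hyperplane gives the multipliers, and strict feasibility makes its
utility component positive. -/
theorem IsMarket.exists_multipliers {φ p Fb u F : ℝ → ℝ} {𝒞 : Set (ℝ → ℝ)} {x₀ ε : ℝ}
    (hM : IsMarket φ p Fb) (h𝒞 : IsQuantileClass 𝒞) (hu : IsUtility u) (hx₀ : 0 < x₀)
    (hε : 0 < ε) (hF : Solves 𝒞 u φ p Fb x₀ ε F)
    (hslater : ∃ G, IsAdmissible 𝒞 φ p Fb G ∧ divInt φ Fb G < ε ∧ costInt p G ≤ x₀) :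
    ∃ lam mu : ℝ, 0 ≤ lam ∧ 0 ≤ mu ∧ lam * (costInt p F - x₀) = 0 ∧
      mu * (divInt φ Fb F - ε) = 0 ∧
      ∀ G, IsAdmissible 𝒞 φ p Fb G →
        expectedUtility u G - lam * costInt p G - mu * divInt φ Fb G ≤
          expectedUtility u F - lam * costInt p F - mu * divInt φ Fb F := by
  obtain ⟨S₀, hS₀, hS₀d, hS₀c⟩ := hslater
  obtain ⟨S, hS, hSd, hSc⟩ := hM.exists_strictly_feasible h𝒞 hx₀ hS₀ hS₀d hS₀c
  obtain ⟨hFa, hFd, hFc⟩ := (hM.mem_feasible_iff h𝒞 hx₀.le hε.le).1 hF.1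
  let A : Set (ℝ × ℝ × ℝ) := ⋃ G ∈ {G | IsAdmissible 𝒞 φ p Fb G},
    Ioi (costInt p G - x₀) ×ˢ Ioi (divInt φ Fb G - ε) ×ˢ
      Ioi (expectedUtility u F - expectedUtility u G)
  have hA : ∀ x : ℝ × ℝ × ℝ, x ∈ A ↔ ∃ G, IsAdmissible 𝒞 φ p Fb G ∧ costInt p G - x₀ < x.1 ∧
      divInt φ Fb G - ε < x.2.1 ∧ expectedUtility u F - expectedUtility u G < x.2.2 := by
    intro x
    simp only [A, mem_iUnion, mem_prod, mem_Ioi, mem_ofPred_eq, exists_prop]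
  have hAopen : IsOpen A := isOpen_biUnion fun G _ => isOpen_Ioi.prod (isOpen_Ioi.prod isOpen_Ioi)
  have hAconv : Convex ℝ A := by
    intro x hx y hy a b ha hb hab
    obtain ⟨G, hG, hG1, hG2, hG3⟩ := (hA x).1 hx
    obtain ⟨H, hH, hH1, hH2, hH3⟩ := (hA y).1 hy
    obtain ⟨h1, h2, h3⟩ := hM.isAdmissible_convexComb h𝒞 hG hH ha hb hab
    have h4 := hu.le_expectedUtility_convexComb (h𝒞.quantile _ hG.mem) (h𝒞.quantile _ hH.mem)
      (h𝒞.integrable _ hG.mem) (h𝒞.integrable _ hH.mem) ha hb hab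
    have hcomb : ∀ {r s r' s' : ℝ}, r < r' → s < s' → a * r + b * s < a * r' + b * s' := by
      intro r s r' s' hr hs
      rcases ha.eq_or_lt with rfl | ha
      · obtain rfl : b = 1 := by linarith
        linarith
      · exact add_lt_add_of_lt_of_le (mul_lt_mul_of_pos_left hr ha)
          (mul_le_mul_of_nonneg_left hs.le hb)
    refine (hA _).2 ⟨_, h1, ?_, ?_, ?_⟩
    · refine lt_of_le_of_lt (le_of_eq ?_) (hcomb hG1 hH1)
      rw [h3]
      linear_combination x₀ * hab
    · refine lt_of_le_of_lt ?_ (hcomb hG2 hH2)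
      linear_combination h2 + ε * hab
    · refine lt_of_le_of_lt ?_ (hcomb hG3 hH3)
      linear_combination h4 - expectedUtility u F * hab
  have hA0 : (0 : ℝ × ℝ × ℝ) ∉ A := by
    intro h
    obtain ⟨G, hG, h1, h2, h3⟩ := (hA _).1 h
    simp only [Prod.fst_zero, Prod.snd_zero] at h1 h2 h3
    have hmem := (hM.mem_feasible_iff h𝒞 hx₀.le hε.le).2
      ⟨hG, (sub_neg.1 h2).le, (sub_neg.1 h1).le⟩
    have := isMaxOn_iff.1 hF.2 G hmem
    linarith
  obtain ⟨f, hf⟩ := geometric_hahn_banach_open_point hAconv hAopen hA0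
  rw [map_zero] at hf
  obtain ⟨l₁, hl₁⟩ : ∃ l, l = -f (1, 0, 0) := ⟨_, rfl⟩
  obtain ⟨l₂, hl₂⟩ : ∃ l, l = -f (0, 1, 0) := ⟨_, rfl⟩
  obtain ⟨l₃, hl₃⟩ : ∃ l, l = -f (0, 0, 1) := ⟨_, rfl⟩
  have hfeq : ∀ a b c : ℝ, f (a, b, c) = -(l₁ * a + l₂ * b + l₃ * c) := by
    intro a b c
    have : ((a, b, c) : ℝ × ℝ × ℝ) = a • (1, 0, 0) + b • (0, 1, 0) + c • (0, 0, 1) := by simp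
    rw [this, map_add, map_add, map_smul, map_smul, map_smul, hl₁, hl₂, hl₃]
    simp only [smul_eq_mul]
    ring
  have hpos : ∀ a b c : ℝ, (a, b, c) ∈ A → 0 < l₁ * a + l₂ * b + l₃ * c := by
    intro a b c h
    have := hf _ h
    rw [hfeq] at this
    linarith
  have hFA : ∀ a b c : ℝ, 0 < a → 0 < b → 0 < c → (a, b, c) ∈ A := fun a b c ha hb hc =>
    (hA _).2 ⟨F, hFa, by simp only; linarith, by simp only; linarith, by simpa using hc⟩
  -- The set contains arbitrarily large triples in each coordinate direction.
  have hl₁0 : 0 ≤ l₁ := nonneg_of_forall_affine_pos (b := l₁ + l₂ + l₃) fun N hN => by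
    have := hpos (N + 1) 1 1 (hFA _ _ _ (by linarith) one_pos one_pos)
    linarith
  have hl₂0 : 0 ≤ l₂ := nonneg_of_forall_affine_pos (b := l₁ + l₂ + l₃) fun N hN => by
    have := hpos 1 (N + 1) 1 (hFA _ _ _ one_pos (by linarith) one_pos)
    linarith
  have hl₃0 : 0 ≤ l₃ := nonneg_of_forall_affine_pos (b := l₁ + l₂ + l₃) fun N hN => by
    have := hpos 1 1 (N + 1) (hFA _ _ _ one_pos one_pos (by linarith))
    linarith
  have hweak : ∀ G, IsAdmissible 𝒞 φ p Fb G → 0 ≤ l₁ * (costInt p G - x₀) +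
      l₂ * (divInt φ Fb G - ε) + l₃ * (expectedUtility u F - expectedUtility u G) := by
    intro G hG
    have hlim : Tendsto (fun e : ℝ => l₁ * (costInt p G - x₀ + e) +
        l₂ * (divInt φ Fb G - ε + e) + l₃ * (expectedUtility u F - expectedUtility u G + e))
        (𝓝[>] 0) (𝓝 (l₁ * (costInt p G - x₀) +
        l₂ * (divInt φ Fb G - ε) + l₃ * (expectedUtility u F - expectedUtility u G))) := by
      have : Continuous (fun e : ℝ => l₁ * (costInt p G - x₀ + e) +
        l₂ * (divInt φ Fb G - ε + e) +
        l₃ * (expectedUtility u F - expectedUtility u G + e)) := by fun_prop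
      simpa using (this.tendsto 0).mono_left nhdsWithin_le_nhds
    refine ge_of_tendsto hlim ?_
    filter_upwards [self_mem_nhdsWithin] with e he
    have he' : 0 < e := he
    exact (hpos _ _ _ ((hA _).2 ⟨G, hG, by simpa using he', by simpa using he',
      by simpa using he'⟩)).le
  -- If `l₃ = 0`, strict feasibility of `S` forces the whole functional to vanish.
  have hl₃pos : 0 < l₃ := by
    refine lt_of_le_of_ne hl₃0 fun h => ?_
    have h1 := hweak S hS
    have h2 := hpos 1 1 1 (hFA _ _ _ one_pos one_pos one_pos)
    rw [← h] at h1 h2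
    have h3 := mul_nonneg hl₁0 (sub_nonneg.2 hSc.le)
    have h4 := mul_nonneg hl₂0 (sub_nonneg.2 hSd.le)
    have h5 : l₁ * (x₀ - costInt p S) = 0 := by linarith
    have h6 : l₂ * (ε - divInt φ Fb S) = 0 := by linarith
    have h7 := (mul_eq_zero.1 h5).resolve_right (sub_pos.2 hSc).ne'
    have h8 := (mul_eq_zero.1 h6).resolve_right (sub_pos.2 hSd).ne'
    rw [h7, h8] at h2
    simp at h2
  have hFw := hweak F hFa
  have h3 := mul_nonneg hl₁0 (sub_nonneg.2 hFc)
  have h4 := mul_nonneg hl₂0 (sub_nonneg.2 hFd)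
  have h5 : l₁ * (costInt p F - x₀) = 0 := by linarith
  have h6 : l₂ * (divInt φ Fb F - ε) = 0 := by linarith
  refine ⟨l₁ / l₃, l₂ / l₃, div_nonneg hl₁0 hl₃0, div_nonneg hl₂0 hl₃0,
    by rw [div_mul_eq_mul_div, h5, zero_div], by rw [div_mul_eq_mul_div, h6, zero_div],
    fun G hG => ?_⟩
  have h7 := hweak G hG
  have h8 : 0 ≤ l₁ * (costInt p G - costInt p F) + l₂ * (divInt φ Fb G - divInt φ Fb F) +
      l₃ * (expectedUtility u F - expectedUtility u G) := by linarith
  have h9 := div_nonneg h8 hl₃0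
  have h10 : (l₁ * (costInt p G - costInt p F) + l₂ * (divInt φ Fb G - divInt φ Fb F) +
      l₃ * (expectedUtility u F - expectedUtility u G)) / l₃ =
      l₁ / l₃ * (costInt p G - costInt p F) + l₂ / l₃ * (divInt φ Fb G - divInt φ Fb F) +
      (expectedUtility u F - expectedUtility u G) := by
    field_simp
  rw [h10] at h9
  linarith

/-! ### Pointwise minimisation of the Lagrangian -/

section Pointwise

variable {u φ p Fb F : ℝ → ℝ} {lam mu : ℝ}

/-- The argument of `(m')⁻¹` in the explicit form. -/
noncomputable def lagrangeTarget (φ p Fb : ℝ → ℝ) (lam mu t : ℝ) : ℝ :=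
  -lam * p (1 - t) + mu * dgen φ (Fb t)

theorem deriv_mFun (hu : IsUtility u) (hφ : IsBregmanGenerator φ) {y : ℝ} (hy : 0 < y) :
    HasDerivAt (mFun u φ mu) (-deriv u y + mu * deriv φ y) y :=
  (hu.differentiableAt hy).hasDerivAt.neg.add
    (((hφ.contDiffOn.differentiableOn one_ne_zero).differentiableAt
      (Ioi_mem_nhds hy)).hasDerivAt.const_mul mu)

theorem strictMonoOn_deriv_mFun (hu : IsUtility u) (hφ : IsBregmanGenerator φ) (hmu : 0 ≤ mu) :
    StrictMonoOn (deriv (mFun u φ mu)) (Ioi 0) := fun x hx y hy hxy => by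
  rw [(deriv_mFun hu hφ hx).deriv, (deriv_mFun hu hφ hy).deriv]
  have h1 := hu.strictAntiOn_deriv hx hy hxy
  have h2 := dgen_mono hφ.convexOn (le_of_lt hx) hxy.le (hφ.differentiableWithinAt hx)
    (hφ.differentiableWithinAt hy)
  rw [dgen_eq_deriv φ hx, dgen_eq_deriv φ hy] at h2
  linarith [mul_le_mul_of_nonneg_left h2 hmu]

theorem continuousOn_deriv_mFun (hu : IsUtility u) (hφ : IsBregmanGenerator φ) :
    ContinuousOn (deriv (mFun u φ mu)) (Ioi 0) :=
  (hu.continuousOn_deriv.neg.add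
    (continuousOn_const.mul (hφ.contDiffOn.continuousOn_deriv_of_isOpen isOpen_Ioi le_rfl))).congr
    fun _ hy => (deriv_mFun hu hφ hy).deriv

/-- The Inada condition at `0` carries over to `m'`, since `φ'` is bounded above near `0`. -/
theorem tendsto_deriv_mFun_zero (hu : IsUtility u) (hφ : IsBregmanGenerator φ) (hmu : 0 ≤ mu) :
    Tendsto (deriv (mFun u φ mu)) (𝓝[>] 0) atBot := by
  have h1 : Tendsto (fun y => -deriv u y + mu * deriv φ 1) (𝓝[>] 0) atBot :=
    tendsto_atBot_add_const_right _ _ (tendsto_neg_atTop_atBot.comp hu.inada_zero)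
  refine tendsto_atBot_mono' _ ?_ h1
  filter_upwards [Ioo_mem_nhdsGT one_pos] with y hy
  rw [(deriv_mFun hu hφ hy.1).deriv, ← dgen_eq_deriv φ hy.1, ← dgen_eq_deriv φ one_pos]
  have := dgen_mono hφ.convexOn hy.1.le hy.2.le (hφ.differentiableWithinAt hy.1)
    (hφ.differentiableWithinAt one_pos)
  linarith [mul_le_mul_of_nonneg_left this hmu]

theorem deriv_hFun (hu : IsUtility u) (hφ : IsBregmanGenerator φ) {y : ℝ} (hy : 0 < y) (t : ℝ) :
    deriv (hFun u φ p Fb lam mu t) y =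
      deriv (mFun u φ mu) y - lagrangeTarget φ p Fb lam mu t := by
  have h1 := deriv_mFun (mu := mu) hu hφ hy
  have h2 := (((hasDerivAt_id y).const_mul lam).mul_const (p (1 - t)))
  have h3 := (hasDerivAt_id y).const_mul (mu * dgen φ (Fb t))
  have h4 := ((h1.add h2).sub h3).deriv
  rw [h1.deriv]
  refine Eq.trans h4 ?_
  unfold lagrangeTarget
  ring

theorem continuousOn_hFun (hu : IsUtility u) (hφ : IsBregmanGenerator φ) (t : ℝ) :
    ContinuousOn (hFun u φ p Fb lam mu t) (Ici 0) := by
  have h1 : ContinuousOn (mFun u φ mu) (Ici 0) :=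
    hu.continuousOn.neg.add (continuousOn_const.mul hφ.continuousOn)
  unfold hFun
  fun_prop

/-- The largest point of `[0, n]` up to which the increasing function `M` stays at most `w`. -/
noncomputable def cappedInv (M : ℝ → ℝ) (n w : ℝ) : ℝ := sSup (insert 0 {y ∈ Ioc 0 n | M y ≤ w})

section CappedInv

variable {M : ℝ → ℝ} {n w : ℝ}

theorem cappedInv_bddAbove (hn : 0 ≤ n) : n ∈ upperBounds (insert 0 {y ∈ Ioc 0 n | M y ≤ w}) := by
  rintro y (rfl | hy)
  exacts [hn, hy.1.2]

theorem cappedInv_mem_Icc (hn : 0 ≤ n) : cappedInv M n w ∈ Icc 0 n :=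
  ⟨le_csSup ⟨n, cappedInv_bddAbove hn⟩ (mem_insert _ _),
    csSup_le (insert_nonempty _ _) (cappedInv_bddAbove hn)⟩

theorem cappedInv_mono (hn : 0 ≤ n) : Monotone (cappedInv M n) := fun _ _ hw =>
  csSup_le_csSup ⟨n, cappedInv_bddAbove hn⟩ (insert_nonempty _ _)
    (insert_subset_insert fun _ hy => ⟨hy.1, hy.2.trans hw⟩)

theorem lt_of_lt_cappedInv (hM : StrictMonoOn M (Ioi 0)) {y : ℝ} (hy : 0 < y)
    (hyc : y < cappedInv M n w) : M y < w := by
  obtain ⟨z, rfl | hz, hyz⟩ := exists_lt_of_lt_csSup (insert_nonempty _ _) hyc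
  · exact absurd hy hyz.le.not_gt
  · exact (hM hy hz.1.1 hyz).trans_le hz.2

theorem lt_of_cappedInv_lt {y : ℝ} (hyc : cappedInv M n w < y) (hyn : y ≤ n) : w < M y := by
  by_contra! h
  have hn : 0 ≤ n := by
    by_contra! hn
    have : cappedInv M n w = 0 := by
      unfold cappedInv
      rw [Ioc_eq_empty (not_lt.2 hn.le)]
      simp
    linarith
  have hy : 0 < y := (cappedInv_mem_Icc hn).1.trans_lt hyc
  exact hyc.not_ge (le_csSup ⟨n, cappedInv_bddAbove hn⟩ (Or.inr ⟨⟨hy, hyn⟩, h⟩))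

end CappedInv

/-- The minimiser of `h_t` on `[0, n]`; it is non-decreasing in `t`. -/
noncomputable def cappedMinimiser (u φ p Fb : ℝ → ℝ) (lam mu n t : ℝ) : ℝ :=
  cappedInv (deriv (mFun u φ mu)) n (lagrangeTarget φ p Fb lam mu t)

theorem strictAntiOn_hFun (hu : IsUtility u) (hφ : IsBregmanGenerator φ) (hmu : 0 ≤ mu)
    (n t : ℝ) : StrictAntiOn (hFun u φ p Fb lam mu t)
      (Icc 0 (cappedMinimiser u φ p Fb lam mu n t)) := by
  refine strictAntiOn_of_deriv_neg (convex_Icc _ _)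
    ((continuousOn_hFun hu hφ t).mono Icc_subset_Ici_self) fun y hy => ?_
  rw [interior_Icc] at hy
  rw [deriv_hFun hu hφ hy.1]
  exact sub_neg.2 (lt_of_lt_cappedInv (strictMonoOn_deriv_mFun hu hφ hmu) hy.1 hy.2)

theorem strictMonoOn_hFun (hu : IsUtility u) (hφ : IsBregmanGenerator φ) {n : ℝ} (hn : 0 ≤ n)
    (t : ℝ) : StrictMonoOn (hFun u φ p Fb lam mu t)
      (Icc (cappedMinimiser u φ p Fb lam mu n t) n) := by
  have h0 : 0 ≤ cappedMinimiser u φ p Fb lam mu n t := (cappedInv_mem_Icc hn).1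
  refine strictMonoOn_of_deriv_pos (convex_Icc _ _)
    ((continuousOn_hFun hu hφ t).mono fun y hy => h0.trans hy.1) fun y hy => ?_
  rw [interior_Icc] at hy
  rw [deriv_hFun hu hφ (h0.trans_lt hy.1)]
  exact sub_pos.2 (lt_of_cappedInv_lt hy.1 hy.2.le)

theorem IsMarket.monotoneOn_lagrangeTarget (hM : IsMarket φ p Fb) (hlam : 0 ≤ lam)
    (hmu : 0 ≤ mu) : MonotoneOn (lagrangeTarget φ p Fb lam mu) (Ioo 0 1) := fun s hs t ht hst => by
  have h1 := mul_le_mul_of_nonneg_left (hM.price_mono (one_sub_mem_Ioo ht) (one_sub_mem_Ioo hs)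
    (by linarith)) hlam
  have h2 := mul_le_mul_of_nonneg_left (hM.monotoneOn_dgen hs ht hst) hmu
  unfold lagrangeTarget
  linarith

theorem IsMarket.monotoneOn_cappedMinimiser (hM : IsMarket φ p Fb) (hlam : 0 ≤ lam)
    (hmu : 0 ≤ mu) {n : ℝ} (hn : 0 ≤ n) :
    MonotoneOn (cappedMinimiser u φ p Fb lam mu n) (Ioo 0 1) := fun _ hs _ ht hst =>
  cappedInv_mono hn (hM.monotoneOn_lagrangeTarget hlam hmu hs ht hst)

/-- A maximiser `F` of the Lagrangian coincides almost everywhere with any monotone competitor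
that lowers `h_t` wherever it differs from `F`, has finite divergence, and exceeds `F` by a
bounded amount. -/
theorem IsMarket.ae_eq_of_hFun_lt {𝒞 : Set (ℝ → ℝ)} {G : ℝ → ℝ} (hM : IsMarket φ p Fb)
    (h𝒞 : IsQuantileClass 𝒞) (hu : IsUtility u) (hF : IsAdmissible 𝒞 φ p Fb F)
    (hL : ∀ G, IsAdmissible 𝒞 φ p Fb G →
      expectedUtility u G - lam * costInt p G - mu * divInt φ Fb G ≤
        expectedUtility u F - lam * costInt p F - mu * divInt φ Fb F)
    (hG : IsNonnegMonotone G) (n C : ℝ) (hGn : ∀ t ∈ Ioo (0 : ℝ) 1, G t ≤ F t + n)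
    (hGC : ∀ t ∈ Ioo (0 : ℝ) 1, bregman φ (G t) (Fb t) ≤ bregman φ (F t) (Fb t) + C)
    (hlt : ∀ t ∈ Ioo (0 : ℝ) 1, G t ≠ F t →
      hFun u φ p Fb lam mu t (G t) < hFun u φ p Fb lam mu t (F t)) :
    G =ᵐ[volume.restrict (Ioo 0 1)] F := by
  obtain ⟨H, hHq, hHG, hHae⟩ := hG.exists_quantile
  have hHn : ∀ t ∈ Ioo (0 : ℝ) 1, H t ≤ F t + n := fun t ht => (hHG t ht).trans (hGn t ht)
  have hHadm : IsAdmissible 𝒞 φ p Fb H := by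
    refine ⟨h𝒞.dominated F hF.mem n H hHq hHn, ?_,
      hM.integrable_cost_of_le hF.cost hHq.isNonnegMonotone n hHn⟩
    refine (hM.integrable_div_of_le hF.div hG C hGC).congr ?_
    filter_upwards [hHae] with t ht
    rw [ht]
  have hopt := hL H hHadm
  have hiu : ∀ K, IsAdmissible 𝒞 φ p Fb K → IntegrableOn (fun t => u (K t)) (Ioo 0 1) :=
    fun K hK => hu.integrable_comp (h𝒞.quantile K hK.mem).isNonnegMonotone
      (h𝒞.integrable K hK.mem)
  have hi1 : ∀ K, IsAdmissible 𝒞 φ p Fb K →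
      IntegrableOn (fun t => u (K t) - lam * (K t * p (1 - t))) (Ioo 0 1) :=
    fun K hK => (hiu K hK).sub (hK.cost.const_mul lam)
  have hi2 : ∀ K, IsAdmissible 𝒞 φ p Fb K → IntegrableOn (fun t => u (K t) -
      lam * (K t * p (1 - t)) - mu * bregman φ (K t) (Fb t)) (Ioo 0 1) :=
    fun K hK => (hi1 K hK).sub (hK.div.const_mul mu)
  have hint : ∀ K, IsAdmissible 𝒞 φ p Fb K →
      ∫ t in Ioo (0 : ℝ) 1, (u (K t) - lam * (K t * p (1 - t)) - mu * bregman φ (K t) (Fb t)) =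
      expectedUtility u K - lam * costInt p K - mu * divInt φ Fb K := fun K hK => by
    rw [integral_sub (hi1 K hK) (hK.div.const_mul mu),
      integral_sub (hiu K hK) (hK.cost.const_mul lam), integral_const_mul, integral_const_mul]
    rfl
  rw [← hint H hHadm, ← hint F hF] at hopt
  have hdiff : ∀ t, (u (G t) - lam * (G t * p (1 - t)) - mu * bregman φ (G t) (Fb t)) -
      (u (F t) - lam * (F t * p (1 - t)) - mu * bregman φ (F t) (Fb t)) =
      hFun u φ p Fb lam mu t (F t) - hFun u φ p Fb lam mu t (G t) := fun t => by
    unfold hFun mFun bregman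
    ring
  have hle : ∀ᵐ t ∂(volume.restrict (Ioo (0 : ℝ) 1)),
      u (F t) - lam * (F t * p (1 - t)) - mu * bregman φ (F t) (Fb t) ≤
      u (H t) - lam * (H t * p (1 - t)) - mu * bregman φ (H t) (Fb t) := by
    filter_upwards [hHae, ae_restrict_mem measurableSet_Ioo] with t ht htI
    rw [ht, ← sub_nonneg, hdiff, sub_nonneg]
    by_cases h : G t = F t
    · rw [h]
    · exact (hlt t htI h).le
  have heq := (integral_eq_iff_of_ae_le (hi2 F hF) (hi2 H hHadm) hle).1
    (le_antisymm (integral_mono_ae (hi2 F hF) (hi2 H hHadm) hle) hopt)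
  filter_upwards [heq, hHae, ae_restrict_mem measurableSet_Ioo] with t ht ht' htI
  rw [ht', ← sub_eq_zero, ← neg_sub, hdiff] at ht
  by_contra h
  linarith [hlt t htI h]

variable {𝒞 : Set (ℝ → ℝ)}

/-- Lowering `F` to the pointwise minimiser on `(0, s]`, where `F` and the benchmark are
bounded. -/
theorem IsMarket.ae_le_cappedMinimiser (hM : IsMarket φ p Fb)
    (h𝒞 : IsQuantileClass 𝒞) (hu : IsUtility u) (hF : IsAdmissible 𝒞 φ p Fb F)
    (hlam : 0 ≤ lam) (hmu : 0 ≤ mu)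
    (hL : ∀ G, IsAdmissible 𝒞 φ p Fb G →
      expectedUtility u G - lam * costInt p G - mu * divInt φ Fb G ≤
        expectedUtility u F - lam * costInt p F - mu * divInt φ Fb F)
    {s n : ℝ} (hs : s ∈ Ioo (0 : ℝ) 1) (hn : F s ≤ n) :
    ∀ᵐ t ∂(volume.restrict (Ioo (0 : ℝ) 1)), t ≤ s →
      F t ≤ cappedMinimiser u φ p Fb lam mu n t := by
  have hFq := h𝒞.quantile F hF.mem
  have hn0 : 0 ≤ n := (hFq.nonneg s hs).trans hn
  set f := cappedMinimiser u φ p Fb lam mu n with hf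
  have hf0 : ∀ t, 0 ≤ f t := fun t => (cappedInv_mem_Icc hn0).1
  have hfm : MonotoneOn f (Ioo 0 1) := hM.monotoneOn_cappedMinimiser hlam hmu hn0
  let G : ℝ → ℝ := fun t => if t ≤ s then min (f t) (F t) else F t
  have hGF : ∀ t, G t ≤ F t := fun t => by
    simp only [G]
    split_ifs
    exacts [min_le_right _ _, le_rfl]
  have hG : IsNonnegMonotone G := by
    refine ⟨fun t ht => ?_, fun a ha b hb hab => ?_⟩
    · simp only [G]
      split_ifs
      exacts [le_min (hf0 t) (hFq.nonneg t ht), hFq.nonneg t ht]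
    · by_cases hbs : b ≤ s
      · simp only [G, if_pos hbs, if_pos (hab.trans hbs)]
        exact min_le_min (hfm ha hb hab) (hFq.monotoneOn ha hb hab)
      · simp only [G, if_neg hbs]
        exact (hGF a).trans (hFq.monotoneOn ha hb hab)
  obtain ⟨C, hC⟩ := exists_bregman_zero_bound hM.generator (Fb s)
  have key := hM.ae_eq_of_hFun_lt h𝒞 hu hF hL hG 0 (max C 0)
    (fun t _ => by simpa using hGF t) ?_ ?_
  · filter_upwards [key] with t ht hts
    simp only [G, if_pos hts] at ht
    exact min_eq_right_iff.1 ht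
  · intro t ht
    have hb0 := hM.benchmark.nonneg t ht
    have hFt := hFq.nonneg t ht
    have hBF := hM.bregman_nonneg hFt ht
    rcases le_or_gt (Fb t) (G t) with h | h
    · have := bregman_le_of_mem_segment hM.generator.convexOn hFt hb0 (hM.differentiable t ht)
        (y := G t) (by rw [segment_symm, segment_eq_Icc (h.trans (hGF t))]; exact ⟨h, hGF t⟩)
      linarith [le_max_right C 0]
    · by_cases hts : t ≤ s
      · have h1 := bregman_le_of_mem_segment hM.generator.convexOn le_rfl hb0
          (hM.differentiable t ht) (y := G t)
          (by rw [segment_eq_Icc hb0]; exact ⟨hG.nonneg t ht, h.le⟩)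
        have h2 := hC (Fb t) ⟨hb0, hM.benchmark.monotoneOn ht hs hts⟩ (hM.differentiable t ht)
        linarith [le_max_left C 0]
      · simp only [G, if_neg hts]
        linarith [le_max_right C 0]
  · intro t ht hne
    by_cases hts : t ≤ s
    · simp only [G, if_pos hts] at hne ⊢
      have hlt : f t < F t := not_le.1 fun h => hne (min_eq_right h)
      rw [min_eq_left hlt.le]
      have hFn : F t ≤ n := (hFq.monotoneOn ht hs hts).trans hn
      exact strictMonoOn_hFun hu hM.generator hn0 t ⟨le_rfl, hlt.le.trans hFn⟩
        ⟨hlt.le, hFn⟩ hlt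
    · simp [G, if_neg hts] at hne

/-- Raising `F` to the pointwise minimiser on `(s, 1)`, where `φ'(Fb)` is bounded below. -/
theorem IsMarket.ae_cappedMinimiser_le (hM : IsMarket φ p Fb)
    (h𝒞 : IsQuantileClass 𝒞) (hu : IsUtility u) (hF : IsAdmissible 𝒞 φ p Fb F)
    (hlam : 0 ≤ lam) (hmu : 0 ≤ mu)
    (hL : ∀ G, IsAdmissible 𝒞 φ p Fb G →
      expectedUtility u G - lam * costInt p G - mu * divInt φ Fb G ≤
        expectedUtility u F - lam * costInt p F - mu * divInt φ Fb F)
    {s n : ℝ} (hs : s ∈ Ioo (0 : ℝ) 1) (hn0 : 0 ≤ n) :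
    ∀ᵐ t ∂(volume.restrict (Ioo (0 : ℝ) 1)), s < t →
      cappedMinimiser u φ p Fb lam mu n t ≤ F t := by
  have hFq := h𝒞.quantile F hF.mem
  set f := cappedMinimiser u φ p Fb lam mu n with hf
  have hfn : ∀ t, f t ∈ Icc 0 n := fun t => cappedInv_mem_Icc hn0
  have hfm : MonotoneOn f (Ioo 0 1) := hM.monotoneOn_cappedMinimiser hlam hmu hn0
  let G : ℝ → ℝ := fun t => if s < t then max (F t) (f t) else F t
  have hGF : ∀ t, F t ≤ G t := fun t => by
    simp only [G]
    split_ifs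
    exacts [le_max_left _ _, le_rfl]
  have hG : IsNonnegMonotone G := by
    refine ⟨fun t ht => (hFq.nonneg t ht).trans (hGF t), fun a ha b hb hab => ?_⟩
    by_cases has : s < a
    · simp only [G, if_pos has, if_pos (has.trans_le hab)]
      exact max_le_max (hFq.monotoneOn ha hb hab) (hfm ha hb hab)
    · simp only [G, if_neg has]
      exact (hFq.monotoneOn ha hb hab).trans (hGF b)
  obtain ⟨C, hC⟩ := exists_bregman_above_bound hM.generator.continuousOn n (dgen φ (Fb s))
  have key := hM.ae_eq_of_hFun_lt h𝒞 hu hF hL hG n (max C 0) ?_ ?_ ?_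
  · filter_upwards [key] with t ht hts
    simp only [G, if_pos hts] at ht
    exact max_eq_left_iff.1 ht
  · intro t ht
    have h0 := hFq.nonneg t ht
    simp only [G]
    split_ifs
    · exact max_le (by linarith) (by linarith [(hfn t).2])
    · linarith
  · intro t ht
    have hb0 := hM.benchmark.nonneg t ht
    have hFt := hFq.nonneg t ht
    have hBF := hM.bregman_nonneg hFt ht
    rcases le_or_gt (G t) (Fb t) with h | h
    · have := bregman_le_of_mem_segment hM.generator.convexOn hFt hb0 (hM.differentiable t ht)
        (y := G t) (by rw [segment_eq_Icc ((hGF t).trans h)]; exact ⟨hGF t, h⟩)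
      linarith [le_max_right C 0]
    · by_cases hGe : G t = F t
      · rw [hGe]
        linarith [le_max_right C 0]
      · have hts : s < t := by
          by_contra hts
          exact hGe (if_neg hts)
        have hGn : G t ≤ n := by
          simp only [G, if_pos hts] at hGe ⊢
          rcases max_choice (F t) (f t) with h' | h'
          · exact absurd h' hGe
          · exact h'.le.trans (hfn t).2
        have := hC (G t) (Fb t) hb0 h.le hGn (hM.monotoneOn_dgen hs ht hts.le)
        linarith [le_max_left C 0]
  · intro t ht hne
    by_cases hts : s < t
    · simp only [G, if_pos hts] at hne ⊢
      have hlt : F t < f t := not_le.1 fun h => hne (max_eq_left h)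
      rw [max_eq_right hlt.le]
      have h0 := hFq.nonneg t ht
      exact strictAntiOn_hFun hu hM.generator hmu n t ⟨h0, hlt.le⟩ ⟨h0.trans hlt.le, le_rfl⟩ hlt
    · simp [G, if_neg hts] at hne

/-- The first-order condition, almost everywhere. -/
theorem IsMarket.ae_deriv_mFun_eq (hM : IsMarket φ p Fb)
    (h𝒞 : IsQuantileClass 𝒞) (hu : IsUtility u) (hF : IsAdmissible 𝒞 φ p Fb F)
    (hlam : 0 ≤ lam) (hmu : 0 ≤ mu)
    (hL : ∀ G, IsAdmissible 𝒞 φ p Fb G →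
      expectedUtility u G - lam * costInt p G - mu * divInt φ Fb G ≤
        expectedUtility u F - lam * costInt p F - mu * divInt φ Fb F)
    {a b : ℝ} (ha : a ∈ Ioo (0 : ℝ) 1) (hb : b ∈ Ioo (0 : ℝ) 1) :
    ∀ᵐ t ∂(volume.restrict (Ioo a b)), 0 < F t ∧
      deriv (mFun u φ mu) (F t) = lagrangeTarget φ p Fb lam mu t := by
  have hFq := h𝒞.quantile F hF.mem
  have hFb := hFq.nonneg b hb
  -- The cap lies strictly above `F` on `(a, b)`, so the capped minimiser is the true one.
  have h1 := hM.ae_le_cappedMinimiser h𝒞 hu hF hlam hmu hL hb (n := F b + 1) (by linarith)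
  have h2 := hM.ae_cappedMinimiser_le h𝒞 hu hF hlam hmu hL ha (n := F b + 1) (by linarith)
  have hsub : Ioo a b ⊆ Ioo 0 1 := Ioo_subset_Ioo ha.1.le hb.2.le
  filter_upwards [ae_restrict_of_ae_restrict_of_subset hsub h1,
    ae_restrict_of_ae_restrict_of_subset hsub h2, ae_restrict_mem measurableSet_Ioo]
    with t ht1 ht2 htI
  have heq : F t = cappedInv (deriv (mFun u φ mu)) (F b + 1) (lagrangeTarget φ p Fb lam mu t) :=
    le_antisymm (ht1 htI.2.le) (ht2 htI.1)
  have hlt : F t < F b + 1 := by linarith [hFq.monotoneOn (hsub htI) hb htI.2.le]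
  have habove : ∀ᶠ y in 𝓝[>] (F t), lagrangeTarget φ p Fb lam mu t ≤
      deriv (mFun u φ mu) y := by
    filter_upwards [Ioo_mem_nhdsGT hlt] with y hy
    exact (lt_of_cappedInv_lt (heq ▸ hy.1) hy.2.le).le
  have hpos : 0 < F t := by
    refine lt_of_le_of_ne (hFq.nonneg t (hsub htI)) fun h0 => ?_
    rw [← h0] at habove
    obtain ⟨y, hy1, hy2⟩ := (habove.and ((tendsto_deriv_mFun_zero hu hM.generator hmu).eventually
      (eventually_lt_atBot (lagrangeTarget φ p Fb lam mu t)))).exists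
    linarith
  have hc : ContinuousAt (deriv (mFun u φ mu)) (F t) :=
    (continuousOn_deriv_mFun hu hM.generator).continuousAt (Ioi_mem_nhds hpos)
  refine ⟨hpos, le_antisymm ?_ (ge_of_tendsto (hc.mono_left nhdsWithin_le_nhds) habove)⟩
  refine le_of_tendsto (hc.mono_left (nhdsWithin_le_nhds (s := Iio (F t)))) ?_
  filter_upwards [Ioo_mem_nhdsLT hpos] with y hy
  exact (lt_of_lt_cappedInv (strictMonoOn_deriv_mFun hu hM.generator hmu) hy.1
    (lt_of_lt_of_eq hy.2 heq)).le

theorem IsMarket.tendsto_dgen_left (hM : IsMarket φ p Fb) {t : ℝ} (ht : t ∈ Ioo (0 : ℝ) 1) :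
    Tendsto (fun s => dgen φ (Fb s)) (𝓝[<] t) (𝓝 (dgen φ (Fb t))) := by
  rcases (hM.benchmark.nonneg t ht).eq_or_lt with h | h
  · -- A benchmark vanishing at `t` vanishes on `(0, t]`.
    refine tendsto_const_nhds.congr' ?_
    filter_upwards [Ioo_mem_nhdsLT ht.1] with s hs
    have hsI : s ∈ Ioo (0 : ℝ) 1 := ⟨hs.1, hs.2.trans ht.2⟩
    rw [le_antisymm (h ▸ hM.benchmark.monotoneOn hsI ht hs.2.le) (hM.benchmark.nonneg s hsI), ← h]
  · exact (hM.generator.continuousAt_dgen h).tendsto.comp (hM.benchmark.leftCont' ht)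

/-- The first-order condition at every `t` such that `p` is continuous at `1 - t`. -/
theorem IsMarket.deriv_mFun_eq (hM : IsMarket φ p Fb)
    (h𝒞 : IsQuantileClass 𝒞) (hu : IsUtility u) (hF : IsAdmissible 𝒞 φ p Fb F)
    (hlam : 0 ≤ lam) (hmu : 0 ≤ mu)
    (hL : ∀ G, IsAdmissible 𝒞 φ p Fb G →
      expectedUtility u G - lam * costInt p G - mu * divInt φ Fb G ≤
        expectedUtility u F - lam * costInt p F - mu * divInt φ Fb F)
    {t : ℝ} (ht : t ∈ Ioo (0 : ℝ) 1) (hpt : ContinuousAt p (1 - t)) :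
    0 < F t ∧ deriv (mFun u φ mu) (F t) = lagrangeTarget φ p Fb lam mu t := by
  have hFq := h𝒞.quantile F hF.mem
  have ha : t / 2 ∈ Ioo (0 : ℝ) 1 := ⟨by linarith [ht.1], by linarith [ht.1, ht.2]⟩
  have hat : t / 2 < t := by linarith [ht.1]
  have hfreq := frequently_nhdsLT_of_ae hat
    (hM.ae_deriv_mFun_eq h𝒞 hu hF hlam hmu hL ha ht)
  have hpos : 0 < F t := by
    obtain ⟨s, hs, hsI⟩ := (hfreq.and_eventually (Ioo_mem_nhdsLT ht.1)).exists
    exact hs.1.trans_le (hFq.monotoneOn ⟨hsI.1, hsI.2.trans ht.2⟩ ht hsI.2.le)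
  have hc : ContinuousAt (deriv (mFun u φ mu)) (F t) :=
    (continuousOn_deriv_mFun hu hM.generator).continuousAt (Ioi_mem_nhds hpos)
  have h1 : Tendsto (fun s => deriv (mFun u φ mu) (F s)) (𝓝[<] t)
      (𝓝 (deriv (mFun u φ mu) (F t))) := hc.tendsto.comp (hFq.leftCont' ht)
  have h2 : Tendsto (fun s => p (1 - s)) (𝓝[<] t) (𝓝 (p (1 - t))) :=
    Tendsto.comp hpt (((continuous_const.sub continuous_id).tendsto t).mono_left
      nhdsWithin_le_nhds)
  have h3 : Tendsto (lagrangeTarget φ p Fb lam mu) (𝓝[<] t)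
      (𝓝 (lagrangeTarget φ p Fb lam mu t)) :=
    (h2.const_mul (-lam)).add ((hM.tendsto_dgen_left ht).const_mul mu)
  exact ⟨hpos, tendsto_nhds_unique_of_frequently_eq h1 h3 (hfreq.mono fun s hs => hs.2)⟩

theorem IsMarket.hasLagrangeForm {x₀ ε : ℝ} (hM : IsMarket φ p Fb) (h𝒞 : IsQuantileClass 𝒞)
    (hu : IsUtility u) (hx₀ : 0 < x₀) (hε : 0 < ε) (hF : Solves 𝒞 u φ p Fb x₀ ε F)
    (hslater : ∃ G, IsAdmissible 𝒞 φ p Fb G ∧ divInt φ Fb G < ε ∧ costInt p G ≤ x₀) :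
    HasLagrangeForm u φ p Fb x₀ ε F := by
  obtain ⟨lam, mu, hlam, hmu, hc, hd, hL⟩ := hM.exists_multipliers h𝒞 hu hx₀ hε hF hslater
  have hFa := ((hM.mem_feasible_iff h𝒞 hx₀.le hε.le).1 hF.1).1
  have hFm := (h𝒞.quantile F hFa.mem).isNonnegMonotone
  have hsm := strictMonoOn_deriv_mFun hu hM.generator hmu
  refine ⟨lam, mu, hlam, hmu, by rwa [hM.toReal_cost hFm], by rwa [hM.toReal_bwDiv hFm],
    hsm.injOn, fun t ht hpt => ?_⟩
  obtain ⟨hpos, heq⟩ := hM.deriv_mFun_eq h𝒞 hu hFa hlam hmu hL ht hpt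
  have hset : {y : ℝ | 0 < y ∧ 0 ≤ deriv (hFun u φ p Fb lam mu t) y} = Ici (F t) := by
    ext y
    constructor
    · rintro ⟨hy, h⟩
      rw [deriv_hFun hu hM.generator hy, ← heq, sub_nonneg] at h
      exact (hsm.le_iff_le hpos hy).1 h
    · intro h
      have hy : 0 < y := hpos.trans_le h
      refine ⟨hy, ?_⟩
      rw [deriv_hFun hu hM.generator hy, ← heq, sub_nonneg]
      exact (hsm.le_iff_le hpos hy).2 h
  have hmem : -lam * p (1 - t) + mu * dgen φ (Fb t) ∈ deriv (mFun u φ mu) '' Ioi 0 :=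
    ⟨F t, hpos, heq⟩
  refine ⟨?_, hmem, ?_⟩
  · have hleast : IsLeast ((fun y : ℝ => (y : EReal)) '' Ici (F t)) (F t : EReal) :=
      ⟨mem_image_of_mem _ self_mem_Ici, by
        rintro _ ⟨y, hy, rfl⟩
        exact EReal.coe_le_coe_iff.2 hy⟩
    rw [lagrangeQuantile, hset]
    exact hleast.isGLB.sInf_eq.symm
  · refine hsm.injOn hpos (Function.invFunOn_mem hmem) ?_
    rw [Function.invFunOn_eq hmem]
    exact heq

end Pointwise

/-! ### Helly's selection theorem and existence of solutions -/

/-- Helly's selection theorem on `(0,1)`: a pointwise bounded sequence of quantile functions has a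
subsequence that converges almost everywhere to a quantile function. -/
theorem exists_subseq_tendsto_quantile {G : ℕ → ℝ → ℝ} (hG : ∀ n, IsNonnegQuantile (G n))
    {b : ℝ → ℝ} (hb : ∀ t ∈ Ioo (0 : ℝ) 1, ∀ n, G n t ≤ b t) :
    ∃ F, IsNonnegQuantile F ∧ ∃ ψ : ℕ → ℕ, StrictMono ψ ∧
      ∀ᵐ t ∂(volume.restrict (Ioo (0 : ℝ) 1)), Tendsto (fun n => G (ψ n) t) atTop (𝓝 (F t)) := by
  -- By compactness, a subsequence converges at all rational points.
  let x : ℕ → ℚ → ℝ := fun n q => (Ioo (0 : ℝ) 1).indicator (G n) q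
  have hx : ∀ n, x n ∈ Set.univ.pi fun q : ℚ => Icc (0 : ℝ) (max (b q) 0) := by
    intro n q _
    by_cases hq : (q : ℝ) ∈ Ioo (0 : ℝ) 1
    · simp only [x, indicator_of_mem hq]
      exact ⟨(hG n).nonneg _ hq, (hb _ hq n).trans (le_max_left _ _)⟩
    · simp only [x, indicator_of_notMem hq]
      exact ⟨le_rfl, le_max_right _ _⟩
  obtain ⟨g, -, ψ, hψ, hlim⟩ :=
    (isCompact_univ_pi fun q : ℚ => isCompact_Icc).tendsto_subseq hx
  have hg : ∀ q : ℚ, (q : ℝ) ∈ Ioo (0 : ℝ) 1 →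
      Tendsto (fun n => G (ψ n) q) atTop (𝓝 (g q)) := fun q hq =>
    (tendsto_pi_nhds.1 hlim q).congr fun n => by
      simp only [x, Function.comp_apply, indicator_of_mem hq]
  have hgb : ∀ t ∈ Ioo (0 : ℝ) 1, ∀ q : ℚ, (q : ℝ) ∈ Ioo 0 t → g q ≤ b t := fun t ht q hq =>
    le_of_tendsto' (hg q ⟨hq.1, hq.2.trans ht.2⟩) fun n =>
      ((hG _).monotoneOn ⟨hq.1, hq.2.trans ht.2⟩ ht hq.2.le).trans (hb t ht _)
  have hg0 : ∀ q : ℚ, (q : ℝ) ∈ Ioo (0 : ℝ) 1 → 0 ≤ g q := fun q hq =>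
    ge_of_tendsto' (hg q hq) fun n => (hG _).nonneg _ hq
  let S : ℝ → Set ℝ := fun t => g '' {q : ℚ | (q : ℝ) ∈ Ioo 0 t}
  have hSne : ∀ t ∈ Ioo (0 : ℝ) 1, (S t).Nonempty := fun t ht => by
    obtain ⟨q, hq⟩ := exists_rat_btwn ht.1
    exact ⟨g q, q, hq, rfl⟩
  have hSbdd : ∀ t ∈ Ioo (0 : ℝ) 1, BddAbove (S t) := fun t ht => ⟨b t, by
    rintro _ ⟨q, hq, rfl⟩
    exact hgb t ht q hq⟩
  let h : ℝ → ℝ := fun t => sSup (S t)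
  have hgh : ∀ t ∈ Ioo (0 : ℝ) 1, ∀ q : ℚ, (q : ℝ) ∈ Ioo 0 t → g q ≤ h t := fun t ht q hq =>
    le_csSup (hSbdd t ht) ⟨q, hq, rfl⟩
  have hh : IsNonnegMonotone h := by
    refine ⟨fun t ht => ?_, fun s hs t ht hst => csSup_le_csSup (hSbdd t ht) (hSne s hs)
      (image_mono fun q hq => ⟨hq.1, hq.2.trans_le hst⟩)⟩
    obtain ⟨q, hq⟩ := exists_rat_btwn ht.1
    exact (hg0 q ⟨hq.1, hq.2.trans ht.2⟩).trans (hgh t ht q hq)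
  obtain ⟨F, hF, -, hFh⟩ := hh.exists_quantile
  refine ⟨F, hF, ψ, hψ, ?_⟩
  filter_upwards [hFh, hh.monotoneOn.countable_not_continuousWithinAt.ae_notMem
    (volume.restrict (Ioo (0 : ℝ) 1)), ae_restrict_mem measurableSet_Ioo] with t hFt hct ht
  -- Convergence holds at the continuity points of the limit.
  have hc : ContinuousAt h t := by
    refine ContinuousWithinAt.continuousAt ?_ (Ioo_mem_nhds ht.1 ht.2)
    by_contra hcon
    exact hct ⟨ht, hcon⟩
  rw [hFt]
  refine tendsto_order.2 ⟨fun a ha => ?_, fun a ha => ?_⟩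
  · obtain ⟨_, ⟨q, hq, rfl⟩, haq⟩ := exists_lt_of_lt_csSup (hSne t ht) ha
    have hqI : (q : ℝ) ∈ Ioo (0 : ℝ) 1 := ⟨hq.1, hq.2.trans ht.2⟩
    filter_upwards [(hg q hqI).eventually (lt_mem_nhds haq)] with n hn
    exact hn.trans_le ((hG _).monotoneOn hqI ht hq.2.le)
  · obtain ⟨t', hta, ht'⟩ := (((hc.mono_left nhdsWithin_le_nhds).eventually
      (gt_mem_nhds ha)).and (Ioo_mem_nhdsGT ht.2)).exists
    obtain ⟨q, hq⟩ := exists_rat_btwn ht'.1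
    have hqI : (q : ℝ) ∈ Ioo (0 : ℝ) 1 := ⟨ht.1.trans hq.1, hq.2.trans ht'.2⟩
    have hgq : g q < a := (hgh t' ⟨ht.1.trans ht'.1, ht'.2⟩ q ⟨hqI.1, hq.2⟩).trans_lt hta
    filter_upwards [(hg q hqI).eventually (gt_mem_nhds hgq)] with n hn
    exact ((hG _).monotoneOn ht hqI hq.1.le).trans_lt hn

/-- Fatou's lemma for an almost everywhere convergent sequence. -/
theorem lintegral_ofReal_le_of_tendsto {α : Type*} [MeasurableSpace α] {μ : Measure α}
    {f : ℕ → α → ℝ} {g : α → ℝ} {c : ENNReal} (hf : ∀ n, AEStronglyMeasurable (f n) μ)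
    (hlim : ∀ᵐ a ∂μ, Tendsto (fun n => f n a) atTop (𝓝 (g a)))
    (hc : ∀ᶠ n in atTop, ∫⁻ a, ENNReal.ofReal (f n a) ∂μ ≤ c) :
    ∫⁻ a, ENNReal.ofReal (g a) ∂μ ≤ c := by
  calc ∫⁻ a, ENNReal.ofReal (g a) ∂μ
      = ∫⁻ a, liminf (fun n => ENNReal.ofReal (f n a)) atTop ∂μ := by
        refine lintegral_congr_ae ?_
        filter_upwards [hlim] with a ha
        exact (ENNReal.tendsto_ofReal ha).liminf_eq.symm
    _ ≤ liminf (fun n => ∫⁻ a, ENNReal.ofReal (f n a) ∂μ) atTop :=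
        lintegral_liminf_le' fun n => (hf n).aemeasurable.ennreal_ofReal
    _ ≤ c := liminf_le_of_frequently_le' hc.frequently

theorem IsNonnegQuantile.le_div_of_integral_le {G : ℝ → ℝ} (hG : IsNonnegQuantile G)
    (hi : IntegrableOn G (Ioo 0 1)) {K : ℝ} (hK : ∫ t in Ioo (0 : ℝ) 1, G t ≤ K) {t : ℝ}
    (ht : t ∈ Ioo (0 : ℝ) 1) : G t ≤ K / (1 - t) := by
  have hsub : Ioo t 1 ⊆ Ioo 0 1 := Ioo_subset_Ioo_left ht.1.le
  rw [le_div_iff₀ (sub_pos.2 ht.2)]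
  calc G t * (1 - t) = ∫ _ in Ioo t 1, G t := by
        simp [measureReal_def, ENNReal.toReal_ofReal (sub_pos.2 ht.2).le, mul_comm]
    _ ≤ ∫ s in Ioo t 1, G s :=
        setIntegral_mono_on (integrable_const _) (hi.mono_set hsub) measurableSet_Ioo
          fun s hs => hG.monotoneOn ht (hsub hs) hs.1.le
    _ ≤ ∫ s in Ioo (0 : ℝ) 1, G s :=
        setIntegral_mono_set hi hG.isNonnegMonotone.ae_nonneg hsub.eventuallyLE
    _ ≤ K := hK

/-- A uniform bound on expectations yields a solution: a maximising sequence converges almost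
everywhere along a subsequence, Fatou's lemma keeps the limit feasible, and sublinearity of the
utility excludes that expected utility drops in the limit. -/
theorem IsMarket.exists_solves {φ p Fb u : ℝ → ℝ} {x₀ ε K : ℝ} (hM : IsMarket φ p Fb)
    (hu : IsUtility u)
    (hne : (feasible quantilesL1 φ p Fb x₀ ε).Nonempty)
    (hK : ∀ G ∈ feasible quantilesL1 φ p Fb x₀ ε, ∫ t in Ioo (0 : ℝ) 1, G t ≤ K) :
    ∃ F, Solves quantilesL1 u φ p Fb x₀ ε F := by
  have hupper : ∀ G ∈ feasible quantilesL1 φ p Fb x₀ ε, ∀ δ C : ℝ, 0 ≤ δ →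
      (∀ y, 0 ≤ y → u y ≤ δ * y + C) → expectedUtility u G ≤ δ * K + C := by
    intro G hG δ C hδ hC
    have hi := hu.integrable_comp hG.1.1.isNonnegMonotone hG.1.2
    have h1 : expectedUtility u G ≤ ∫ t in Ioo (0 : ℝ) 1, (δ * G t + C) :=
      integral_mono_ae hi ((hG.1.2.const_mul δ).add (integrable_const C))
        (hG.1.1.isNonnegMonotone.ae_nonneg.mono fun t ht => hC _ ht)
    rw [integral_add (hG.1.2.const_mul δ) (integrable_const C), integral_const_mul] at h1
    have h2 := mul_le_mul_of_nonneg_left (hK G hG) hδ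
    simp only [integral_const, probReal_univ, one_smul] at h1
    linarith
  obtain ⟨C₁, hC₁⟩ := hu.exists_le_linear one_pos
  have hbdd : BddAbove (expectedUtility u '' feasible quantilesL1 φ p Fb x₀ ε) :=
    ⟨1 * K + C₁, by
      rintro _ ⟨G, hG, rfl⟩
      exact hupper G hG 1 C₁ zero_le_one hC₁⟩
  obtain ⟨v, -, hvlim, hv⟩ := exists_seq_tendsto_sSup (hne.image (expectedUtility u)) hbdd
  set S := sSup (expectedUtility u '' feasible quantilesL1 φ p Fb x₀ ε) with hS
  choose G hG hGv using hv
  obtain ⟨F, hF, ψ, hψ, hlim⟩ := exists_subseq_tendsto_quantile (fun n => (hG n).1.1)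
    (b := fun t => K / (1 - t)) fun t ht n =>
      (hG n).1.1.le_div_of_integral_le (hG n).1.2 (hK _ (hG n)) ht
  have hlimI : ∀ᵐ t ∂(volume.restrict (Ioo (0 : ℝ) 1)), ∀ g : ℝ → ℝ, ContinuousOn g (Ici 0) →
      Tendsto (fun n => g (G (ψ n) t)) atTop (𝓝 (g (F t))) := by
    filter_upwards [hlim, ae_restrict_mem measurableSet_Ioo] with t ht htI g hg
    exact (hg (F t) (hF.nonneg t htI)).tendsto.comp (tendsto_nhdsWithin_iff.2
      ⟨ht, Eventually.of_forall fun n => (hG _).1.1.nonneg t htI⟩)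
  have hK0 : 0 ≤ K := by
    obtain ⟨H, hH⟩ := hne
    exact (integral_nonneg_of_ae hH.1.1.isNonnegMonotone.ae_nonneg).trans (hK H hH)
  have hFm := hF.isNonnegMonotone
  have hGm : ∀ n, IsNonnegMonotone (G (ψ n)) := fun n => (hG _).1.1.isNonnegMonotone
  have hFi : IntegrableOn F (Ioo 0 1) := by
    refine ((lintegral_ofReal_le_iff hFm.aemeasurable.aestronglyMeasurable hFm.ae_nonneg hK0).1
      (lintegral_ofReal_le_of_tendsto (f := fun n => G (ψ n))
        (fun n => (hGm n).aemeasurable.aestronglyMeasurable) hlim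
        (Eventually.of_forall fun n => ?_))).1
    exact (lintegral_ofReal_le_iff (hGm n).aemeasurable.aestronglyMeasurable (hGm n).ae_nonneg
      hK0).2 ⟨(hG _).1.2, hK _ (hG _)⟩
  have hFfeas : F ∈ feasible quantilesL1 φ p Fb x₀ ε := by
    refine ⟨⟨hF, hFi⟩, ?_, ?_⟩
    · refine lintegral_ofReal_le_of_tendsto
        (f := fun n t => bregman φ (G (ψ n) t) (Fb t))
        (fun n => hM.aestronglyMeasurable_bregman (hGm n)) ?_
        (Eventually.of_forall fun n => (hG _).2.1)
      filter_upwards [hlimI] with t ht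
      refine ht (fun y => bregman φ y (Fb t)) ?_
      have := hM.generator.continuousOn
      unfold bregman
      fun_prop
    · refine lintegral_ofReal_le_of_tendsto (f := fun n t => G (ψ n) t * p (1 - t))
        (fun n => hM.aestronglyMeasurable_cost (hGm n)) ?_
        (Eventually.of_forall fun n => (hG _).2.2)
      filter_upwards [hlim] with t ht
      exact ht.mul_const _
  refine ⟨F, hFfeas, isMaxOn_iff.2 fun H hH => ?_⟩
  refine (le_csSup hbdd (mem_image_of_mem _ hH)).trans ?_
  -- Fatou's lemma for the non-negative functions `δ G + C - u(G)` along the maximising sequence.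
  have hkey : ∀ δ : ℝ, 0 < δ → S ≤ expectedUtility u F + δ * (K + 1) := by
    intro δ hδ
    obtain ⟨C, hC⟩ := hu.exists_le_linear hδ
    have hint : ∀ H : ℝ → ℝ, IsNonnegMonotone H → IntegrableOn H (Ioo 0 1) →
        IntegrableOn (fun t => δ * H t + C - u (H t)) (Ioo 0 1) ∧
        ∫ t in Ioo (0 : ℝ) 1, (δ * H t + C - u (H t)) =
          δ * (∫ t in Ioo (0 : ℝ) 1, H t) + C - expectedUtility u H := by
      intro H hH hHi
      have h1 := (hHi.const_mul δ).add (integrable_const (μ := volume.restrict (Ioo 0 1)) C)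
      refine ⟨h1.sub (hu.integrable_comp hH hHi), ?_⟩
      refine (integral_sub h1 (hu.integrable_comp hH hHi)).trans ?_
      congr 1
      refine (integral_add (hHi.const_mul δ) (integrable_const C)).trans ?_
      simp [integral_const_mul]
    have hnn : ∀ H : ℝ → ℝ, IsNonnegMonotone H →
        0 ≤ᵐ[volume.restrict (Ioo (0 : ℝ) 1)] fun t => δ * H t + C - u (H t) := fun H hH =>
      hH.ae_nonneg.mono fun t ht => sub_nonneg.2 (hC _ ht)
    have hFint := hint F hFm hFi
    have hSup : S ≤ δ * K + C := csSup_le (hne.image _) (by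
      rintro _ ⟨H, hH, rfl⟩
      exact hupper H hH δ C hδ.le hC)
    have hfatou := (lintegral_ofReal_le_iff (c := δ * K + C - S + δ) hFint.1.1 (hnn F hFm)
      (by linarith)).1 (lintegral_ofReal_le_of_tendsto
        (f := fun n t => δ * G (ψ n) t + C - u (G (ψ n) t))
        (fun n => (hint _ (hGm n) (hG _).1.2).1.1) ?_ ?_)
    · have h2 := hfatou.2
      rw [hFint.2] at h2
      have h3 : 0 ≤ ∫ t in Ioo (0 : ℝ) 1, F t := integral_nonneg_of_ae hFm.ae_nonneg
      have h4 := mul_nonneg hδ.le h3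
      linarith
    · filter_upwards [hlimI] with t ht
      refine ht (fun y => δ * y + C - u y) ?_
      have := hu.continuousOn
      fun_prop
    · have hv' : Tendsto (fun n => expectedUtility u (G (ψ n))) atTop (𝓝 S) := by
        refine (hvlim.comp hψ.tendsto_atTop).congr fun n => ?_
        simp [hGv]
      filter_upwards [hv'.eventually (lt_mem_nhds (sub_lt_self S hδ))] with n hn
      have h5 := hint _ (hGm n) (hG (ψ n)).1.2
      refine (lintegral_ofReal_le_iff h5.1.1 (hnn _ (hGm n)) (by linarith)).2 ⟨h5.1, ?_⟩
      rw [h5.2]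
      have := mul_le_mul_of_nonneg_left (hK _ (hG (ψ n))) hδ.le
      linarith
  refine le_of_forall_pos_le_add fun η hη => ?_
  have h6 := hkey (η / (K + 1)) (div_pos hη (by linarith))
  rwa [div_mul_cancel₀ _ (show K + 1 ≠ 0 by linarith)] at h6

/-! ### Uniform integrability bounds under the three well-posedness conditions -/

section Bounds

variable {φ p Fb : ℝ → ℝ} {x₀ ε : ℝ} {G : ℝ → ℝ}

theorem IsMarket.integral_le_of_le_price (hM : IsMarket φ p Fb) (hx₀ : 0 ≤ x₀) (hε : 0 ≤ ε)
    {c : ℝ} (hc : 0 < c) (hp : ∀ t ∈ Ioo (0 : ℝ) 1, c ≤ p t)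
    (hG : G ∈ feasible quantilesL1 φ p Fb x₀ ε) : ∫ t in Ioo (0 : ℝ) 1, G t ≤ c⁻¹ * x₀ := by
  obtain ⟨h1, -, h3⟩ := (hM.mem_feasible_iff isQuantileClass_L1 hx₀ hε).1 hG
  refine (integral_mono_ae hG.1.2 (h1.cost.const_mul c⁻¹) ?_).trans ?_
  · filter_upwards [ae_restrict_mem measurableSet_Ioo] with t ht
    rw [inv_mul_eq_div, le_div_iff₀ hc]
    exact mul_le_mul_of_nonneg_left (hp _ (one_sub_mem_Ioo ht)) (hG.1.1.nonneg t ht)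
  · rw [integral_const_mul]
    exact mul_le_mul_of_nonneg_left h3 (inv_pos.2 hc).le

theorem IsMarket.integral_le_of_le_bregman (hM : IsMarket φ p Fb) (hx₀ : 0 ≤ x₀) (hε : 0 ≤ ε)
    {A : ℝ → ℝ} (hA : IntegrableOn A (Ioo 0 1)) {C : ℝ} (hC : 0 ≤ C)
    (hb : ∀ t ∈ Ioo (0 : ℝ) 1, ∀ y, 0 ≤ y → y ≤ A t + C * bregman φ y (Fb t))
    (hG : G ∈ feasible quantilesL1 φ p Fb x₀ ε) :
    ∫ t in Ioo (0 : ℝ) 1, G t ≤ (∫ t in Ioo (0 : ℝ) 1, A t) + C * ε := by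
  obtain ⟨h1, h2, -⟩ := (hM.mem_feasible_iff isQuantileClass_L1 hx₀ hε).1 hG
  refine (integral_mono_ae hG.1.2 (hA.add (h1.div.const_mul C)) ?_).trans ?_
  · filter_upwards [ae_restrict_mem measurableSet_Ioo] with t ht
    exact hb t ht _ (hG.1.1.nonneg t ht)
  · refine (integral_add hA (h1.div.const_mul C)).trans_le ?_
    rw [integral_const_mul]
    have := mul_le_mul_of_nonneg_left h2 hC
    unfold divInt at this
    linarith

theorem IsMarket.exists_bound_of_stronglyConvex (hM : IsMarket φ p Fb) (hx₀ : 0 ≤ x₀)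
    (hε : 0 ≤ ε) (hs : IsStronglyConvex φ) (hb : Fb ∈ quantilesL2) :
    ∃ K, ∀ G ∈ feasible quantilesL1 φ p Fb x₀ ε, ∫ t in Ioo (0 : ℝ) 1, G t ≤ K := by
  obtain ⟨θ, hθ, h⟩ := hs
  refine ⟨_, fun G hG => hM.integral_le_of_le_bregman hx₀ hε (A := fun t => Fb t + 1)
    ((quantilesL2_subset_quantilesL1 hb).2.add (integrable_const 1))
    (C := 2 / θ) (by positivity) (fun t ht y hy => ?_) hG⟩
  have h1 := sq_le_bregman hM.generator h hy (hM.benchmark.nonneg t ht) (hM.differentiable t ht)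
  have h2 := mul_le_mul_of_nonneg_left h1 (show 0 ≤ 2 / θ by positivity)
  have h3 : 2 / θ * (θ / 2 * (y - Fb t) ^ 2) = (y - Fb t) ^ 2 := by field_simp
  rw [h3] at h2
  -- With `x = y - Fb t`, this is `x ≤ 1 + x ^ 2`.
  nlinarith [sq_nonneg (y - Fb t - 1 / 2)]

theorem IsMarket.mem_quantilesL2_of_stronglyConvex (hM : IsMarket φ p Fb) (hx₀ : 0 ≤ x₀)
    (hε : 0 ≤ ε) (hs : IsStronglyConvex φ) (hb : Fb ∈ quantilesL2)
    (hG : G ∈ feasible quantilesL1 φ p Fb x₀ ε) : G ∈ quantilesL2 := by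
  obtain ⟨θ, hθ, h⟩ := hs
  obtain ⟨h1, -, -⟩ := (hM.mem_feasible_iff isQuantileClass_L1 hx₀ hε).1 hG
  have hGm := hG.1.1.isNonnegMonotone.aemeasurable.aestronglyMeasurable
  have hFm := hM.benchmark.isNonnegMonotone.aemeasurable.aestronglyMeasurable
  have hdiff : MemLp (fun t => G t - Fb t) 2 (volume.restrict (Ioo 0 1)) := by
    refine (memLp_two_iff_integrable_sq (hGm.sub hFm)).2 ?_
    refine (h1.div.const_mul (2 / θ)).mono' ((hGm.sub hFm).pow 2) ?_
    filter_upwards [ae_restrict_mem measurableSet_Ioo] with t ht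
    have h2 := sq_le_bregman hM.generator h (hG.1.1.nonneg t ht) (hM.benchmark.nonneg t ht)
      (hM.differentiable t ht)
    have h3 := mul_le_mul_of_nonneg_left h2 (show 0 ≤ 2 / θ by positivity)
    have h4 : 2 / θ * (θ / 2 * (G t - Fb t) ^ 2) = (G t - Fb t) ^ 2 := by field_simp
    rw [h4] at h3
    simpa [abs_of_nonneg (sq_nonneg (G t - Fb t))] using h3
  refine ⟨hG.1.1, (memLp_two_iff_integrable_sq hGm).1 ?_⟩
  convert hdiff.add (memLp_of_mem_quantilesL2 hb) using 1
  ext t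
  simp

theorem IsMarket.exists_bound_of_strictConvexOn (hM : IsMarket φ p Fb) (hx₀ : 0 ≤ x₀)
    (hε : 0 ≤ ε) (hs : StrictConvexOn ℝ (Ici 0) φ) {M : ℝ}
    (hb : ∀ t ∈ Ioo (0 : ℝ) 1, Fb t ≤ M) :
    ∃ K, ∀ G ∈ feasible quantilesL1 φ p Fb x₀ ε, ∫ t in Ioo (0 : ℝ) 1, G t ≤ K := by
  obtain ⟨κ, hκ, h⟩ := exists_linear_le_bregman hM.generator hs
    (show 0 < max M 1 from one_pos.trans_le (le_max_right _ _))
  refine ⟨_, fun G hG => hM.integral_le_of_le_bregman hx₀ hε (A := fun _ => max M 1 + 1)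
    (integrable_const _) (C := κ⁻¹) (inv_pos.2 hκ).le (fun t ht y hy => ?_) hG⟩
  have h1 := h y (Fb t) hy ⟨hM.benchmark.nonneg t ht, (hb t ht).trans (le_max_left _ _)⟩
    (hM.differentiable t ht)
  have h2 := mul_le_mul_of_nonneg_left h1 (inv_pos.2 hκ).le
  rw [inv_mul_cancel_left₀ hκ.ne'] at h2
  linarith

end Bounds

/-! ### The market generated by the state price density and the benchmark -/

section Probability

variable {Ω : Type*} [MeasurableSpace Ω] {P Q : Measure Ω} [IsProbabilityMeasure P]

theorem measurable_statePriceDensity (P Q : Measure Ω) (r T : ℝ) :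
    Measurable (statePriceDensity P Q r T) :=
  (Measure.measurable_rnDeriv Q P).ennreal_toReal.const_mul _

theorem isNonnegQuantile_quantileOf {X : Ω → ℝ} (hX : AEMeasurable X P)
    (h0 : ∀ᵐ ω ∂P, 0 ≤ X ω) : IsNonnegQuantile (quantileOf P X) := by
  have := Measure.isProbabilityMeasure_map hX
  exact ⟨fun t ht => le_quantile_of_ae ((ae_map_iff hX measurableSet_Ici).2 h0) ht,
    monotoneOn_quantile, fun t ht => quantile_leftCont ht⟩

theorem integrableOn_comp_quantileOf {X : Ω → ℝ} (hX : AEMeasurable X P) {g : ℝ → ℝ}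
    (hg : Measurable g) (hi : Integrable (fun ω => g (X ω)) P) :
    IntegrableOn (fun t => g (quantileOf P X t)) (Ioo 0 1) := by
  have := Measure.isProbabilityMeasure_map hX
  exact integrableOn_quantile_comp
    ((integrable_map_measure hg.aestronglyMeasurable hX).2 hi)

theorem quantileOf_mem_quantilesL2 {X : Ω → ℝ} (hX : MemLp X 2 P) (h0 : ∀ᵐ ω ∂P, 0 ≤ X ω) :
    quantileOf P X ∈ quantilesL2 :=
  ⟨isNonnegQuantile_quantileOf hX.1.aemeasurable h0,
    integrableOn_comp_quantileOf hX.1.aemeasurable (measurable_id.pow_const 2) hX.integrable_sq⟩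

theorem isMarket_quantileOf [IsFiniteMeasure Q] {r T : ℝ}
    (hpos : ∀ᵐ ω ∂P, 0 < statePriceDensity P Q r T ω) {φ : ℝ → ℝ} (hφ : IsBregmanGenerator φ)
    {Xb : Ω → ℝ} (hXb : AEMeasurable Xb P) (hXb0 : ∀ᵐ ω ∂P, 0 ≤ Xb ω)
    (hφ0 : DifferentiableWithinAt ℝ φ (Ici 0) 0 ∨ ∀ᵐ ω ∂P, 0 < Xb ω) :
    IsMarket φ (quantileOf P (statePriceDensity P Q r T)) (quantileOf P Xb) := by
  have hξ := measurable_statePriceDensity P Q r T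
  have hFb := isNonnegQuantile_quantileOf hXb hXb0
  have hp := isNonnegQuantile_quantileOf hξ.aemeasurable (hpos.mono fun _ h => h.le)
  refine ⟨hφ, hFb, fun t ht => ?_, fun t ht => ?_, hp.monotoneOn, ?_⟩
  · rcases (hFb.nonneg t ht).eq_or_lt with h | h
    · rcases hφ0 with hφ0 | hφ0
      · exact h ▸ hφ0
      · have := Measure.isProbabilityMeasure_map hXb
        exact absurd h (ne_of_lt
          (lt_quantile_of_ae ((ae_map_iff hXb measurableSet_Ioi).2 hφ0) ht))
    · exact hφ.differentiableWithinAt h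
  · have := Measure.isProbabilityMeasure_map (μ := P) hξ.aemeasurable
    exact lt_quantile_of_ae ((ae_map_iff hξ.aemeasurable measurableSet_Ioi).2 hpos) ht
  · have h1 : IntegrableOn (quantileOf P (statePriceDensity P Q r T)) (Ioo 0 1) :=
      integrableOn_comp_quantileOf hξ.aemeasurable measurable_id
        (Measure.integrable_toReal_rnDeriv.const_mul _)
    have h2 := (Measure.measurePreserving_sub_left volume (1 : ℝ)).integrableOn_comp_preimage
      (Homeomorph.subLeft (1 : ℝ)).measurableEmbedding (f :=
        quantileOf P (statePriceDensity P Q r T)) (s := Ioo 0 1)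
    have h3 : (fun t : ℝ => 1 - t) ⁻¹' Ioo 0 1 = Ioo 0 1 := by simp
    rw [h3] at h2
    exact h2.2 h1

/-- A positive essential infimum of the state price density bounds its quantile function below. -/
theorem exists_le_quantileOf_of_essInf_pos {X : Ω → ℝ} (hX : AEMeasurable X P)
    (h : 0 < essInf X P) : ∃ c > 0, ∀ t ∈ Ioo (0 : ℝ) 1, c ≤ quantileOf P X t := by
  rw [essInf, liminf_eq] at h
  obtain ⟨c, hc, hc0⟩ : ∃ c ∈ {a | ∀ᶠ ω in ae P, a ≤ X ω}, 0 < c := by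
    rcases {a : ℝ | ∀ᶠ ω in ae P, a ≤ X ω}.eq_empty_or_nonempty with he | hne
    · -- The supremum of the empty set is `0`, which the hypothesis excludes.
      rw [he, Real.sSup_empty] at h
      exact absurd h (lt_irrefl 0)
    · exact exists_lt_of_lt_csSup hne h
  have := Measure.isProbabilityMeasure_map hX
  exact ⟨c, hc0, fun t ht => le_quantile_of_ae ((ae_map_iff hX measurableSet_Ici).2 hc) ht⟩

theorem quantileOf_le_of_ae_le {X : Ω → ℝ} (hX : AEMeasurable X P) {M : ℝ}
    (h : ∀ᵐ ω ∂P, X ω ≤ M) : ∀ t ∈ Ioo (0 : ℝ) 1, quantileOf P X t ≤ M := fun _ ht => by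
  have := Measure.isProbabilityMeasure_map hX
  exact quantile_le_of_ae ((ae_map_iff hX measurableSet_Iic).2 h) ht

end Probability

end BWPortfolio

/-! ### Existence, uniqueness and explicit form of the solutions -/

open BWPortfolio

theorem mainTheorem3
    {Ω : Type*} [MeasurableSpace Ω] (P Q : Measure Ω)
    [IsProbabilityMeasure P] [IsProbabilityMeasure Q] (hQP : Q ≪ P) (r T : ℝ)
    -- the state price density is positive and continuously distributed
    (hpos : ∀ᵐ ω ∂P, 0 < BWPortfolio.statePriceDensity P Q r T ω)
    (hcont : Continuous (cdf (P.map (BWPortfolio.statePriceDensity P Q r T))))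
    -- the utility function, the Bregman generator, and the benchmark's terminal wealth
    (u : ℝ → ℝ) (hu : BWPortfolio.IsUtility u)
    (φ : ℝ → ℝ) (hφ : BWPortfolio.IsBregmanGenerator φ)
    (Xb : Ω → ℝ) (hXb : AEMeasurable Xb P) (hXb0 : ∀ᵐ ω ∂P, 0 ≤ Xb ω)
    -- the divergence from the benchmark is defined
    (hφ0 : DifferentiableWithinAt ℝ φ (Ici 0) 0 ∨ ∀ᵐ ω ∂P, 0 < Xb ω)
    -- the quantile functions of the state price density and of the benchmark
    (p Fb : ℝ → ℝ) (hp : p = BWPortfolio.quantileOf P (BWPortfolio.statePriceDensity P Q r T))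
    (hFb : Fb = BWPortfolio.quantileOf P Xb)
    (x₀ ε : ℝ) (hx₀ : 0 < x₀) (hε : 0 < ε)
    -- some feasible quantile function satisfies the divergence constraint strictly
    (hslater : ∃ G ∈ BWPortfolio.feasible BWPortfolio.quantilesL2 φ p Fb x₀ ε,
      BWPortfolio.bwDiv φ G Fb < ENNReal.ofReal ε)
    -- at least one of the three well-posedness conditions holds
    (hwell : 0 < essInf (BWPortfolio.statePriceDensity P Q r T) P ∨
      (BWPortfolio.IsStronglyConvex φ ∧ MemLp Xb 2 P) ∨
      (StrictConvexOn ℝ (Ici 0) φ ∧ ∃ M : ℝ, ∀ᵐ ω ∂P, Xb ω ≤ M)) :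
    -- every optimal quantile function is the unique one, and has the explicit form
    (∀ F, BWPortfolio.Solves BWPortfolio.quantilesL2 u φ p Fb x₀ ε F →
      BWPortfolio.IsUniqueSolution BWPortfolio.quantilesL2 u φ p Fb x₀ ε F ∧
      BWPortfolio.HasLagrangeForm u φ p Fb x₀ ε F) ∧
    -- under the second condition it exists among the square-integrable quantile functions
    (BWPortfolio.IsStronglyConvex φ ∧ MemLp Xb 2 P →
      ∃ F, BWPortfolio.Solves BWPortfolio.quantilesL2 u φ p Fb x₀ ε F) ∧
    -- under each of the three it exists among the integrable ones, with the same explicit form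
    (∃ F, BWPortfolio.IsUniqueSolution BWPortfolio.quantilesL1 u φ p Fb x₀ ε F ∧
      BWPortfolio.HasLagrangeForm u φ p Fb x₀ ε F) := by

  have hM : IsMarket φ p Fb := by
    rw [hp, hFb]
    exact isMarket_quantileOf hpos hφ hXb hXb0 hφ0
  obtain ⟨G₀, hG₀, hG₀ε⟩ := hslater
  have hG₀' := (hM.mem_feasible_iff isQuantileClass_L2 hx₀.le hε.le).1 hG₀
  have hG₀div : divInt φ Fb G₀ < ε := by
    have h1 := (ENNReal.toReal_lt_toReal hG₀ε.ne_top ENNReal.ofReal_ne_top).2 hG₀ε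
    rwa [hM.toReal_bwDiv hG₀.1.1.isNonnegMonotone, ENNReal.toReal_ofReal hε.le] at h1
  have hslater₂ : ∃ G, IsAdmissible quantilesL2 φ p Fb G ∧ divInt φ Fb G < ε ∧
      costInt p G ≤ x₀ := ⟨G₀, hG₀'.1, hG₀div, hG₀'.2.2⟩
  have hslater₁ : ∃ G, IsAdmissible quantilesL1 φ p Fb G ∧ divInt φ Fb G < ε ∧
      costInt p G ≤ x₀ :=
    ⟨G₀, ⟨quantilesL2_subset_quantilesL1 hG₀'.1.mem, hG₀'.1.div, hG₀'.1.cost⟩, hG₀div, hG₀'.2.2⟩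
  have hne : (feasible quantilesL1 φ p Fb x₀ ε).Nonempty :=
    ⟨G₀, quantilesL2_subset_quantilesL1 hG₀.1, hG₀.2⟩
  have hFb2 : MemLp Xb 2 P → Fb ∈ quantilesL2 := fun h =>
    hFb ▸ quantileOf_mem_quantilesL2 h hXb0
  refine ⟨fun F hF => ⟨hM.isUniqueSolution isQuantileClass_L2 hu hx₀.le hε.le hF,
    hM.hasLagrangeForm isQuantileClass_L2 hu hx₀ hε hF hslater₂⟩, ?_, ?_⟩
  · rintro ⟨hs, hX⟩
    obtain ⟨K, hK⟩ := hM.exists_bound_of_stronglyConvex hx₀.le hε.le hs (hFb2 hX)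
    obtain ⟨F, hF⟩ := hM.exists_solves hu hne hK
    refine ⟨F, ⟨hM.mem_quantilesL2_of_stronglyConvex hx₀.le hε.le hs (hFb2 hX) hF.1, hF.1.2⟩, ?_⟩
    exact hF.2.on_subset fun G hG => ⟨quantilesL2_subset_quantilesL1 hG.1, hG.2⟩
  · have hK : ∃ K, ∀ G ∈ feasible quantilesL1 φ p Fb x₀ ε, ∫ t in Ioo (0 : ℝ) 1, G t ≤ K := by
      rcases hwell with h | ⟨hs, hX⟩ | ⟨hs, M, hXM⟩
      · obtain ⟨c, hc, hcp⟩ :=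
          exists_le_quantileOf_of_essInf_pos (measurable_statePriceDensity P Q r T).aemeasurable h
        exact ⟨_, fun G hG => hM.integral_le_of_le_price hx₀.le hε.le hc (hp ▸ hcp) hG⟩
      · exact hM.exists_bound_of_stronglyConvex hx₀.le hε.le hs (hFb2 hX)
      · exact hM.exists_bound_of_strictConvexOn hx₀.le hε.le hs
          (hFb ▸ quantileOf_le_of_ae_le hXb hXM)
    obtain ⟨K, hK⟩ := hK
    obtain ⟨F, hF⟩ := hM.exists_solves hu hne hK
    exact ⟨F, hM.isUniqueSolution isQuantileClass_L1 hu hx₀.le hε.le hF,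
      hM.hasLagrangeForm isQuantileClass_L1 hu hx₀ hε hF hslater₁⟩
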